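/- Let $\mathcal X\subseteq A^{\mathbb Z}$ and $\mathcal Y\subseteq B^{\mathbb Z}$ be shifts over finite alphabets (nonempty closed sets of bi-infinite sequences with $\sigma(\mathcal X)=\mathcal X$, $\sigma(\mathcal Y)=\mathcal Y$, where $\sigma$ is the shift map) that are flow equivalent, i.e. related by the least equivalence relation between shifts that contains conjugacy and symbol expansion. Here a symbol expansion of $\mathcal X$ is the least subshift $\mathcal X'$ of $(A\cup\{\diamond\})^{\mathbb Z}$, $\diamond\notin A$, whose set of blocks contains $\mathcal E(L(\mathcal X))$, where $L(\mathcal X)$ is the set of blocks (nonempty finite factors) of elements of $\mathcal X$ and, for some letter $\alpha\in A$, $\mathcal E$ is the homomorphism with $\mathcal E(\alpha)=\alpha\diamond$ and $\mathcal E(a)=a$ for $a\in A\setminus\{\alpha\}$. Let $S(\mathcal X)$ be the syntactic semigroup with zero of $L(\mathcal X)$, that is, the quotient of the free semigroup with zero $A^+\cup\{0\}$ by the congruence identifying $u$ and $v$ if they have the same contexts $[u]=\{(x,y)\in A^*\times A^*: xuy\in L(\mathcal X)\}$ (with $[0]=\emptyset$). It acts on the right on the pointed set $$Q(\mathcal X)=\{C_{\mathcal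 X}(x): x\in A^{\mathbb Z^-}\}\cup\{\emptyset\},\qquad C_{\mathcal X}(x)=\{y\in A^{\mathbb N}: x.y\in\mathcal X\},$$ with base point $\emptyset$ (the vertices of the right Krieger cover together with a sink), by $C_{\mathcal X}(x)\cdot[u]=C_{\mathcal X}(xu)$ for $u\in A^+$, $\emptyset\cdot s=\emptyset$ and $q\cdot 0=\emptyset$. For a semigroup $S$ with zero, let $\mathbb K(S)$ be its Karoubi envelope: the category with zero whose objects are the idempotents of $S$ and whose morphisms from $f$ to $e$ are the triples $(e,s,f)$ with $s\in eSf$, with composition $(e,s,f)(f,t,g)=(e,st,g)$. A right action of $S$ on a pointed set $Q$ (with $q\cdot 0=0$ and $0\cdot s=0$, where $0\in Q$ is the base point) induces the contravariant zero-preserving functor $\mathbb A_Q$ from $\mathbb K(S)$ to pointed sets with $\mathbb A_Q(e)=Qe$ and $q\cdot(e,s,f)=q\cdot s$ for $q\in Qe$. Put $\mathbb K(\mathcal X)=\mathbb K(S(\mathcal X))$ and $\mathbb A_{\mathcal X}=\mathbb A_{Q(\mathcal X)}$. Call actions $(\mathbb A,C)$ and $(\mathbb B,D)$ of small categories with zero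 on pointed sets equivalent if there are a zero-preserving equivalence of categories $F\colon C\to D$ and a natural isomorphism $\eta\colon\mathbb A\Rightarrow\mathbb B\circ F$. Then the actions $(\mathbb A_{\mathcal X},\mathbb K(\mathcal X))$ and $(\mathbb A_{\mathcal Y},\mathbb K(\mathcal Y))$ are equivalent. Consequently, every Karoubi invariant of the action of $S(\mathcal X)$ on $Q(\mathcal X)$ is an invariant of flow equivalence: if $I$ assigns an object $I(Q,S)$ of a category to each action of a semigroup $S$ with zero on a pointed set $Q$, in such a way that $I(Q,S)\cong I(Q',T)$ whenever $(\mathbb A_Q,\mathbb K(S))$ and $(\mathbb A_{Q'},\mathbb K(T))$ are equivalent, then $I(Q(\mathcal X),S(\mathcal X))\cong I(Q(\mathcal Y),S(\mathcal Y))$. -/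

import Mathlib

open CategoryTheory CategoryTheory.Limits SymbolicDynamics.FullShift

universe u v w

namespace ShiftKaroubi

/-! ### Actions of categories with zero on pointed sets

Categories with zero are Mathlib's categories with `HasZeroMorphisms`, pointed sets are the objects
of Mathlib's category `Pointed`. -/

/-- A (right) action of a category with zero `C` on a pointed set `Q`: a contravariant zero-preserving
functor from `C` to pointed sets whose values `obj c` are pointed subsets of `Q`. For `s : c ⟶ d` and
`q ∈ obj d`, the element `map s q` is `q · s`. -/
structure CategoryAction (C : Type v) [Category.{w} C] [HasZeroMorphisms C] (Q : Pointed.{u}) where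
  obj : C → Set Q
  point_mem : ∀ c, Q.point ∈ obj c
  map : ∀ {c d : C}, (c ⟶ d) → obj d → obj c
  map_point : ∀ {c d : C} (s : c ⟶ d), map s ⟨Q.point, point_mem d⟩ = ⟨Q.point, point_mem c⟩
  map_id : ∀ (c : C) (q : obj c), map (𝟙 c) q = q
  map_comp : ∀ {c d e : C} (s : c ⟶ d) (t : d ⟶ e) (q : obj e), map (s ≫ t) q = map s (map t q)
  map_zero : ∀ {c d : C} (q : obj d), map (0 : c ⟶ d) q = ⟨Q.point, point_mem c⟩

/-- The contravariant functor to pointed sets underlying an action. -/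
def CategoryAction.functor {C : Type v} [Category.{w} C] [HasZeroMorphisms C] {Q : Pointed.{u}}
    (𝔸 : CategoryAction C Q) : Cᵒᵖ ⥤ Pointed.{u} where
  obj c := ⟨𝔸.obj c.unop, ⟨Q.point, 𝔸.point_mem c.unop⟩⟩
  map s := ⟨𝔸.map s.unop, 𝔸.map_point s.unop⟩
  map_id c := Pointed.Hom.ext (funext fun q => 𝔸.map_id c.unop q)
  map_comp s t := Pointed.Hom.ext (funext fun q => 𝔸.map_comp t.unop s.unop q)

/-- A morphism of actions of categories with zero on pointed sets: a zero-preserving functor `F`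
together with a natural transformation from the first action to the composite of the second one
with `F`. -/
structure CategoryAction.Morphism {C D : Type v} [Category.{w} C] [HasZeroMorphisms C]
    [Category.{w} D] [HasZeroMorphisms D] {Q R : Pointed.{u}}
    (𝔸 : CategoryAction C Q) (𝔹 : CategoryAction D R) where
  F : C ⥤ D
  preservesZero : F.PreservesZeroMorphisms
  η : 𝔸.functor ⟶ F.op ⋙ 𝔹.functor

/-- Two actions are equivalent if there is a morphism `(η, F)` between them such that `F` is an
equivalence of categories and `η` is a natural isomorphism. -/
def CategoryAction.Equivalent {C D : Type v} [Category.{w} C] [HasZeroMorphisms C]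
    [Category.{w} D] [HasZeroMorphisms D] {Q R : Pointed.{u}}
    (𝔸 : CategoryAction C Q) (𝔹 : CategoryAction D R) : Prop :=
  ∃ Φ : 𝔸.Morphism 𝔹, Φ.F.IsEquivalence ∧ IsIso Φ.η

/-! ### The Karoubi envelope of a semigroup with zero -/

/-- Objects of the Karoubi envelope of `S`: the idempotents of `S`. -/
structure Karoubi (S : Type u) [SemigroupWithZero S] : Type u where
  idem : S
  isIdem : IsIdempotentElem idem

namespace Karoubi

variable {S : Type u} [SemigroupWithZero S]

/-- A morphism from `f` to `e` is a triple `(e, s, f)` with `s ∈ eSf`, that is `s = e s f`. -/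
@[ext]
structure Hom (f e : Karoubi S) : Type u where
  val : S
  mem : e.idem * val * f.idem = val

theorem Hom.left_mul {f e : Karoubi S} (s : Hom f e) : e.idem * s.val = s.val := by
  rw [← s.mem, ← mul_assoc, ← mul_assoc, e.isIdem]

theorem Hom.mul_right {f e : Karoubi S} (s : Hom f e) : s.val * f.idem = s.val := by
  rw [← s.mem, mul_assoc, f.isIdem]

/-- Composition is `(e, s, f) (f, t, g) = (e, s t, g)`; in Mathlib's notation `t ≫ s` is `s` after
`t`. -/
instance : Category.{u} (Karoubi S) where
  Hom := Hom
  id e := ⟨e.idem, by rw [e.isIdem, e.isIdem]⟩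
  comp t s := ⟨s.val * t.val, by
    rw [← mul_assoc, s.left_mul, mul_assoc, t.mul_right]⟩
  id_comp s := Hom.ext s.mul_right
  comp_id s := Hom.ext s.left_mul
  assoc _ _ _ := Hom.ext (mul_assoc _ _ _).symm

instance : HasZeroMorphisms (Karoubi S) where
  zero f e := ⟨(⟨0, by simp⟩ : Hom f e)⟩
  comp_zero _ _ := Hom.ext (zero_mul _)
  zero_comp _ _ _ _ := Hom.ext (mul_zero _)

end Karoubi

/-- A (right) action of a semigroup with zero `S` on a pointed set `Q`. -/
structure SemigroupAction₀ (S : Type u) [SemigroupWithZero S] (Q : Pointed.{u}) where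
  act : Q → S → Q
  act_mul : ∀ q s t, act q (s * t) = act (act q s) t
  point_act : ∀ s, act Q.point s = Q.point
  act_zero : ∀ q, act q 0 = Q.point

/-- The action of the Karoubi envelope of `S` induced by an action of `S` on `Q`: it sends the
idempotent `e` to `Qe`, and `q · (e, s, f) = q · s`. -/
def SemigroupAction₀.karoubi {S : Type u} [SemigroupWithZero S] {Q : Pointed.{u}}
    (μ : SemigroupAction₀ S Q) : CategoryAction (Karoubi S) Q where
  obj e := Set.range fun q => μ.act q e.idem
  point_mem e := ⟨Q.point, μ.point_act _⟩
  map {f e} s q := ⟨μ.act q.1 (Karoubi.Hom.val s), ⟨μ.act q.1 (Karoubi.Hom.val s), by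
    exact (μ.act_mul _ _ _).symm.trans (congrArg _ (Karoubi.Hom.mul_right s))⟩⟩
  map_point s := Subtype.ext (μ.point_act _)
  map_id e := by
    rintro ⟨_, q, rfl⟩
    refine Subtype.ext ?_
    change μ.act (μ.act q e.idem) e.idem = μ.act q e.idem
    rw [← μ.act_mul, e.isIdem]
  map_comp s t q := Subtype.ext (μ.act_mul _ _ _)
  map_zero q := Subtype.ext (μ.act_zero _)

/-- An assignment of an object of a category `𝒞` to each action of a semigroup with zero on a pointed
set is a Karoubi invariant if it takes isomorphic values on actions whose induced actions of Karoubi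
envelopes are equivalent. -/
def IsKaroubiInvariant {𝒞 : Type v} [Category.{w} 𝒞]
    (I : ∀ (S : Type u) [SemigroupWithZero S] (Q : Pointed.{u}), SemigroupAction₀ S Q → 𝒞) : Prop :=
  ∀ (S T : Type u) [SemigroupWithZero S] [SemigroupWithZero T] (Q R : Pointed.{u})
    (μ : SemigroupAction₀ S Q) (ν : SemigroupAction₀ T R),
    μ.karoubi.Equivalent ν.karoubi → Nonempty (I S Q μ ≅ I T R ν)

/-! ### The syntactic semigroup of a language -/

section Syntactic

variable {A : Type u}

/-- A nonempty word as a list of letters. -/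
def letters (u : FreeSemigroup A) : List A := u.head :: u.tail

theorem letters_mul (u v : FreeSemigroup A) : letters (u * v) = letters u ++ letters v := by
  simp [letters]

/-- The context in `L` of an element of the free semigroup with zero; the context of `0` is empty. -/
def context (L : Language A) (u : WithZero (FreeSemigroup A)) : Set (List A × List A) :=
  {p | ∃ w : FreeSemigroup A, u = w ∧ p.1 ++ letters w ++ p.2 ∈ L}

theorem mem_context_coe {L : Language A} {w : FreeSemigroup A} {p : List A × List A} :
    p ∈ context L (w : WithZero (FreeSemigroup A)) ↔ p.1 ++ letters w ++ p.2 ∈ L := by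
  constructor
  · rintro ⟨w', h, h'⟩
    rwa [WithZero.coe_inj.1 h]
  · exact fun h => ⟨w, rfl, h⟩

theorem context_zero (L : Language A) : context L 0 = ∅ := by
  ext p
  simp only [context, Set.mem_ofPred_eq, Set.mem_empty_iff_false, iff_false]
  rintro ⟨w, h, -⟩
  exact WithZero.coe_ne_zero h.symm

theorem mem_context_mul_coe {L : Language A} {u : WithZero (FreeSemigroup A)} {w : FreeSemigroup A}
    {p : List A × List A} : p ∈ context L (u * w) ↔ (p.1, letters w ++ p.2) ∈ context L u := by
  cases u using WithZero.recZeroCoe with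
  | zero => simp [context_zero]
  | coe u => rw [← WithZero.coe_mul, mem_context_coe, mem_context_coe, letters_mul]; simp

theorem mem_context_coe_mul {L : Language A} {u : WithZero (FreeSemigroup A)} {w : FreeSemigroup A}
    {p : List A × List A} : p ∈ context L (w * u) ↔ (p.1 ++ letters w, p.2) ∈ context L u := by
  cases u using WithZero.recZeroCoe with
  | zero => simp [context_zero]
  | coe u => rw [← WithZero.coe_mul, mem_context_coe, mem_context_coe, letters_mul]; simp

/-- The syntactic congruence: two elements are equivalent if they have the same contexts. -/
def syntacticCon (L : Language A) : Con (WithZero (FreeSemigroup A)) where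
  r u v := context L u = context L v
  iseqv := ⟨fun _ => rfl, fun h => h.symm, fun h h' => h.trans h'⟩
  mul' {u u' v v'} h h' := by
    have h1 : context L (u * v) = context L (u' * v) := by
      cases v using WithZero.recZeroCoe with
      | zero => simp
      | coe v => ext p; rw [mem_context_mul_coe, mem_context_mul_coe, h]
    have h2 : context L (u' * v) = context L (u' * v') := by
      cases u' using WithZero.recZeroCoe with
      | zero => simp
      | coe u' => ext p; rw [mem_context_coe_mul, mem_context_coe_mul, h']
    exact h1.trans h2

/-- The syntactic semigroup (with zero) of a language. -/
abbrev SyntacticSemigroup (L : Language A) : Type u := (syntacticCon L).Quotient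

instance (L : Language A) : SemigroupWithZero (SyntacticSemigroup L) where
  zero := ((0 : WithZero (FreeSemigroup A)) : (syntacticCon L).Quotient)
  mul_assoc a b c := mul_assoc a b c
  zero_mul a := by
    induction a using Con.induction_on with
    | _ a => exact congrArg _ (zero_mul a)
  mul_zero a := by
    induction a using Con.induction_on with
    | _ a => exact congrArg _ (mul_zero a)

end Syntactic

/-! ### Shift spaces and flow equivalence -/

/-- A shift: a nonempty closed shift-invariant set of bi-infinite sequences over a finite (discrete)
alphabet. -/
structure ShiftSpace : Type (u + 1) where
  alphabet : Type u
  [finite : Finite alphabet]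
  [top : TopologicalSpace alphabet]
  [discrete : DiscreteTopology alphabet]
  toSubshift : Subshift alphabet ℤ
  nonempty : toSubshift.carrier.Nonempty

attribute [instance] ShiftSpace.finite ShiftSpace.top ShiftSpace.discrete

/-- The word `x_i x_{i+1} ⋯ x_{i+n-1}`. -/
def block {A : Type u} (x : ℤ → A) (i : ℤ) (n : ℕ) : List A :=
  (List.range n).map fun k : ℕ => x (i + (k : ℤ))

/-- The language of all (nonempty) blocks of elements of a set of bi-infinite sequences. -/
def blocks {A : Type u} (X : Set (ℤ → A)) : Language A :=
  {w | ∃ x ∈ X, ∃ (i : ℤ) (n : ℕ), w = block x i (n + 1)}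

/-- The language of a shift. -/
def ShiftSpace.language (X : ShiftSpace.{u}) : Language X.alphabet :=
  blocks X.toSubshift.carrier

/-- Two shifts are conjugate if there is a homeomorphism between them commuting with the shift
maps. -/
def Conjugate (X Y : ShiftSpace.{u}) : Prop :=
  ∃ Φ : X.toSubshift.carrier ≃ₜ Y.toSubshift.carrier, ∀ x : X.toSubshift.carrier,
    (Φ ⟨shift 1 x.1, X.toSubshift.mapsTo 1 x.2⟩ : ℤ → Y.alphabet) = shift 1 (Φ x).1

open Classical in
/-- The symbol expansion `A* → (A ∪ {◇})*` associated to the letter `α`, sending `α` to `α◇` and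
fixing all other letters of `A`. The alphabet `A ∪ {◇}` is `Option A`, with `none` as `◇`. -/
noncomputable def expandWord {A : Type u} (α : A) (u : List A) : List (Option A) :=
  u.flatMap fun a => if a = α then [some α, none] else [some a]

/-- `X'` is a symbol expansion of `X`: up to an identification of its alphabet with the alphabet of
`X` plus a new letter, it is the least subshift whose language contains the symbol expansions,
relatively to some letter, of the words of the language of `X`. -/
def IsSymbolExpansion (X X' : ShiftSpace.{u}) : Prop :=
  ∃ (ι : Option X.alphabet ≃ X'.alphabet) (α : X.alphabet),
    (∀ u ∈ X.language, (expandWord α u).map ι ∈ X'.language) ∧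
    ∀ Z : Subshift X'.alphabet ℤ,
      (∀ u ∈ X.language, (expandWord α u).map ι ∈ blocks Z.carrier) →
        X'.toSubshift.carrier ⊆ Z.carrier

/-- Flow equivalence: the least equivalence relation between shifts containing the conjugacy and the
symbol expansion relations. -/
def FlowEquivalent : ShiftSpace.{u} → ShiftSpace.{u} → Prop :=
  Relation.EqvGen fun X Y => Conjugate X Y ∨ IsSymbolExpansion X Y

/-! ### The Krieger cover -/

section Sequences

variable {A : Type u}

/-- The sequence `x.y`. Left-infinite sequences `⋯ x_{-3} x_{-2} x_{-1}` are represented by functions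
`x` on `ℕ`, with `x n` the letter at position `-(n + 1)`. -/
def joinSeq (x y : ℕ → A) : ℤ → A
  | Int.ofNat n => y n
  | Int.negSucc n => x n

/-- Insertion of a letter at index `0`. On right-infinite sequences this is `a y_0 y_1 ⋯`, on
left-infinite sequences it is `⋯ x_{-2} x_{-1} a`. -/
def consSeq (a : A) (y : ℕ → A) : ℕ → A
  | 0 => a
  | n + 1 => y n

/-- The left-infinite sequence `xu`. -/
def appendWord (x : ℕ → A) : List A → ℕ → A
  | [] => x
  | a :: u => appendWord (consSeq a x) u

/-- The right-infinite sequence `uy`. -/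
def prependWord : List A → (ℕ → A) → ℕ → A
  | [], y => y
  | a :: u, y => consSeq a (prependWord u y)

/-- The set of right-infinite sequences `y` such that `x.y ∈ X`. -/
def futures (X : Set (ℤ → A)) (x : ℕ → A) : Set (ℕ → A) := {y | joinSeq x y ∈ X}

theorem shift_joinSeq (x y : ℕ → A) (a : A) :
    shift 1 (joinSeq x (consSeq a y)) = joinSeq (consSeq a x) y := by
  funext i
  rw [shift_apply]
  rcases i with n | n
  · have : (1 : ℤ) + Int.ofNat n = Int.ofNat (n + 1) := by simp; omega
    rw [this]; rfl
  · rcases n with _ | n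
    · rfl
    · have : (1 : ℤ) + Int.negSucc (n + 1) = Int.negSucc n := by omega
      rw [this]; rfl

theorem block_append (x : ℤ → A) (i : ℤ) (m n : ℕ) :
    block x i (m + n) = block x i m ++ block x (i + m) n := by
  simp [block, List.range_add, add_assoc]

theorem block_joinSeq_prependWord (x y : ℕ → A) (u : List A) (n : ℕ) :
    block (joinSeq x (prependWord u y)) 0 (u.length + n) = u ++ (List.range n).map y := by
  have key : ∀ z : ℕ → A, ∀ m, block (joinSeq x z) 0 m = (List.range m).map z := by
    intro z m
    refine List.map_congr_left fun k _ => ?_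
    rw [zero_add]; rfl
  rw [key]
  induction u with
  | nil => simp [prependWord]
  | cons a u ih =>
    rw [List.length_cons, show u.length + 1 + n = (u.length + n) + 1 by omega,
      List.range_succ_eq_map, List.map_cons, List.map_map, List.cons_append, ← ih]
    rfl

theorem block_window (x y : ℕ → A) (u : List A) (n : ℕ) :
    block (joinSeq x (prependWord u y)) (-n) (n + (u.length + n)) =
      block (joinSeq x y) (-n) n ++ u ++ (List.range n).map y := by
  rw [block_append, neg_add_cancel, block_joinSeq_prependWord, List.append_assoc]
  congr 1
  refine List.map_congr_left fun k hk => ?_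
  have hk : k < n := List.mem_range.1 hk
  have : (-(n : ℤ) + k) = Int.negSucc (n - k - 1) := by omega
  rw [this]; rfl

variable [TopologicalSpace A]

theorem shift_mem_iff (X : Subshift A ℤ) (i : ℤ) (x : ℤ → A) :
    shift i x ∈ X.carrier ↔ x ∈ X.carrier := by
  refine ⟨fun h => ?_, fun h => X.mapsTo i h⟩
  have := X.mapsTo (-i) h
  rwa [← shift_add, add_neg_cancel, shift_zero] at this

theorem mem_futures_appendWord (X : Subshift A ℤ) (u : List A) (x y : ℕ → A) :
    y ∈ futures X.carrier (appendWord x u) ↔ prependWord u y ∈ futures X.carrier x := by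
  induction u generalizing x with
  | nil => rfl
  | cons a u ih =>
    rw [appendWord, ih, prependWord, futures, futures, Set.mem_ofPred_eq, Set.mem_ofPred_eq,
      ← shift_joinSeq, shift_mem_iff]

theorem mem_of_windows [DiscreteTopology A] (X : Subshift A ℤ) (z : ℤ → A) (m : ℕ)
    (h : ∀ n : ℕ, ∃ x ∈ X.carrier, ∃ i : ℤ,
      block z (-n) (n + (m + n)) = block x i (n + (m + n))) :
    z ∈ X.carrier := by
  rw [← X.isClosed.closure_eq, mem_closure_iff_nhds]
  intro t ht
  rw [nhds_pi, Filter.mem_pi] at ht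
  obtain ⟨I, hI, U, hU, hUt⟩ := ht
  obtain ⟨N, hN⟩ : ∃ N : ℕ, ∀ i ∈ I, -(N : ℤ) ≤ i ∧ i < N := by
    obtain ⟨N, hN⟩ := (hI.image Int.natAbs).bddAbove
    refine ⟨N + 1, fun i hi => ?_⟩
    have := hN (Set.mem_image_of_mem _ hi)
    omega
  obtain ⟨x, hx, i, hxi⟩ := h N
  refine ⟨shift (i + N) x, hUt fun j hj => ?_, X.mapsTo _ hx⟩
  obtain ⟨h1, h2⟩ := hN j hj
  obtain ⟨k, hk⟩ := Int.eq_ofNat_of_zero_le (show 0 ≤ j + N by omega)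
  have hkl : k < N + (m + N) := by omega
  have e := List.map_inj_left.1 hxi k (List.mem_range.2 hkl)
  have e1 : -(N : ℤ) + k = j := by omega
  have e2 : i + (k : ℤ) = i + N + j := by omega
  rw [e1, e2] at e
  rw [shift_apply, ← e]
  exact mem_of_mem_nhds (hU j)

/-- If `u` and `v` have the same contexts, then `xu` and `xv` have the same futures. -/
theorem futures_appendWord_subset [DiscreteTopology A] (X : Subshift A ℤ)
    {u : FreeSemigroup A} {v : WithZero (FreeSemigroup A)}
    (h : context (blocks X.carrier) u = context (blocks X.carrier) v) {x y : ℕ → A}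
    (hy : y ∈ futures X.carrier (appendWord x (letters u))) :
    ∃ w : FreeSemigroup A, v = w ∧ y ∈ futures X.carrier (appendWord x (letters w)) := by
  rw [mem_futures_appendWord] at hy
  have hc : ∀ n : ℕ, (block (joinSeq x y) (-n) n, (List.range n).map y) ∈
      context (blocks X.carrier) v := by
    intro n
    rw [← h, mem_context_coe, ← block_window]
    exact ⟨_, hy, -n, n + (u.tail.length + n), by simp [letters]; congr 1; omega⟩
  obtain ⟨w, rfl, -⟩ := hc 0
  refine ⟨w, rfl, ?_⟩
  rw [mem_futures_appendWord]
  refine mem_of_windows X _ (letters w).length fun n => ?_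
  obtain ⟨x', hx', i, k, e⟩ := mem_context_coe.1 (hc n)
  rw [← block_window] at e
  have hl := congrArg List.length e
  simp only [block, List.length_map, List.length_range] at hl
  exact ⟨x', hx', i, by rw [e, hl]⟩

end Sequences

/-- The syntactic semigroup of a shift. -/
abbrev ShiftSpace.S (X : ShiftSpace.{u}) : Type u := SyntacticSemigroup X.language

/-- The set `C_X(x)` of right-infinite sequences `y` such that `x.y ∈ X`. -/
def ShiftSpace.C (X : ShiftSpace.{u}) (x : ℕ → X.alphabet) : Set (ℕ → X.alphabet) :=
  futures X.toSubshift.carrier x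

/-- The pointed set `Q(X)` of vertices of the right Krieger cover together with the sink `∅`. -/
def ShiftSpace.Q (X : ShiftSpace.{u}) : Pointed.{u} where
  X := {q : Set (ℕ → X.alphabet) // q ∈ Set.range X.C ∪ {∅}}
  point := ⟨∅, Or.inr rfl⟩

/-- The vertex `C_X(x)`. -/
def ShiftSpace.vertex (X : ShiftSpace.{u}) (x : ℕ → X.alphabet) : X.Q := ⟨X.C x, Or.inl ⟨x, rfl⟩⟩

/-- The transition `q · u = {y | uy ∈ q}` for a word `u`, and `q · 0 = ∅`. By `futures_transition`,
`C_X(x) · u = C_X(xu)`. -/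
def transition {A : Type u} (q : Set (ℕ → A)) (u : WithZero (FreeSemigroup A)) : Set (ℕ → A) :=
  {y | ∃ w : FreeSemigroup A, u = w ∧ prependWord (letters w) y ∈ q}

theorem transition_coe {A : Type u} (q : Set (ℕ → A)) (u : FreeSemigroup A) :
    transition q u = {y | prependWord (letters u) y ∈ q} := by
  ext y
  constructor
  · rintro ⟨w, h, h'⟩
    rwa [WithZero.coe_inj.1 h]
  · exact fun h => ⟨u, rfl, h⟩

theorem transition_zero {A : Type u} (q : Set (ℕ → A)) : transition q 0 = ∅ := by
  ext y
  simp only [transition, Set.mem_ofPred_eq, Set.mem_empty_iff_false, iff_false]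
  rintro ⟨w, h, -⟩
  exact WithZero.coe_ne_zero h.symm

theorem transition_empty {A : Type u} (u : WithZero (FreeSemigroup A)) :
    transition ∅ u = ∅ := by
  ext y
  simp [transition]

theorem prependWord_append {A : Type u} (u v : List A) (y : ℕ → A) :
    prependWord (u ++ v) y = prependWord u (prependWord v y) := by
  induction u with
  | nil => rfl
  | cons a u ih => rw [List.cons_append, prependWord, ih]; rfl

theorem transition_mul {A : Type u} (q : Set (ℕ → A)) (u v : WithZero (FreeSemigroup A)) :
    transition q (u * v) = transition (transition q u) v := by
  cases v using WithZero.recZeroCoe with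
  | zero => rw [mul_zero, transition_zero, transition_zero]
  | coe v =>
    cases u using WithZero.recZeroCoe with
    | zero => rw [zero_mul, transition_zero, transition_empty]
    | coe u =>
      rw [← WithZero.coe_mul, transition_coe, transition_coe, transition_coe, letters_mul]
      simp only [prependWord_append, Set.mem_ofPred_eq]

theorem ShiftSpace.futures_transition (X : ShiftSpace.{u}) (x : ℕ → X.alphabet)
    (u : FreeSemigroup X.alphabet) : transition (X.C x) u = X.C (appendWord x (letters u)) := by
  rw [transition_coe]
  ext y
  exact (mem_futures_appendWord _ _ _ _).symm

theorem ShiftSpace.transition_mem (X : ShiftSpace.{u}) {q : Set (ℕ → X.alphabet)}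
    (hq : q ∈ Set.range X.C ∪ {∅}) (u : WithZero (FreeSemigroup X.alphabet)) :
    transition q u ∈ Set.range X.C ∪ {∅} := by
  cases u using WithZero.recZeroCoe with
  | zero => exact Or.inr (transition_zero q)
  | coe u =>
    rcases hq with ⟨x, rfl⟩ | rfl
    · exact Or.inl ⟨_, (X.futures_transition x u).symm⟩
    · exact Or.inr (transition_empty _)

theorem ShiftSpace.transition_congr (X : ShiftSpace.{u}) {q : Set (ℕ → X.alphabet)}
    (hq : q ∈ Set.range X.C ∪ {∅}) {u v : WithZero (FreeSemigroup X.alphabet)}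
    (h : syntacticCon X.language u v) : transition q u = transition q v := by
  have key : ∀ u v : WithZero (FreeSemigroup X.alphabet), context X.language u = context X.language v →
      transition q u ⊆ transition q v := by
    rintro u v h y ⟨u, rfl, hy⟩
    rcases hq with ⟨x, rfl⟩ | rfl
    · obtain ⟨w, rfl, hw⟩ := futures_appendWord_subset X.toSubshift h (x := x) (y := y)
        ((mem_futures_appendWord _ _ _ _).2 hy)
      exact ⟨w, rfl, (mem_futures_appendWord _ _ _ _).1 hw⟩
    · exact absurd hy (Set.notMem_empty _)
  exact (key u v h).antisymm (key v u h.symm)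

/-- The action of the syntactic semigroup `S(X)` on `Q(X)`, given by `C_X(x) · [u] = C_X(xu)`,
`∅ · [u] = ∅` and `q · 0 = ∅`. -/
def ShiftSpace.kriegerAction (X : ShiftSpace.{u}) : SemigroupAction₀ X.S X.Q where
  act q s := Con.liftOn s (fun u => ⟨transition q.1 u, X.transition_mem q.2 u⟩)
    fun _ _ h => Subtype.ext (X.transition_congr q.2 h)
  act_mul q s t := by
    induction s using Con.induction_on with
    | _ s =>
      induction t using Con.induction_on with
      | _ t => exact Subtype.ext (transition_mul _ _ _)
  point_act s := by
    induction s using Con.induction_on with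
    | _ s => exact Subtype.ext (transition_empty _)
  act_zero q := Subtype.ext (transition_zero _)

theorem ShiftSpace.kriegerAction_vertex (X : ShiftSpace.{u}) (x : ℕ → X.alphabet)
    (u : FreeSemigroup X.alphabet) :
    X.kriegerAction.act (X.vertex x)
        (((u : WithZero (FreeSemigroup X.alphabet)) : (syntacticCon X.language).Quotient)) =
      X.vertex (appendWord x (letters u)) :=
  Subtype.ext (X.futures_transition x u)

/-- The Karoubi envelope of a shift. -/
abbrev ShiftSpace.𝕂 (X : ShiftSpace.{u}) : Type u := Karoubi X.S

/-- The action of the Karoubi envelope of a shift on `Q(X)`. -/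
def ShiftSpace.𝔸 (X : ShiftSpace.{u}) : CategoryAction X.𝕂 X.Q := X.kriegerAction.karoubi

end ShiftKaroubi

open ShiftKaroubi

namespace ShiftKaroubi

/-! ### Equivalence of actions is an equivalence relation -/

section Equivalent

variable {C D E : Type v} [Category.{w} C] [HasZeroMorphisms C] [Category.{w} D]
  [HasZeroMorphisms D] [Category.{w} E] [HasZeroMorphisms E] {P Q R : Pointed.{u}}

/-! Equivalence of actions is reflexive, symmetric and transitive, so only the two generators of
flow equivalence matter. Both come from `Recognizable` substitutions `f`: the factors of images of
words of X are the words of Y, images are desubstituted uniquely away from margins of bounded length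
k, and periodic words of Y are, up to rotation (a period may start inside the image of a letter),
images of periodic words of X. A symbol expansion is such a substitution with k = 0. A conjugacy is
a zigzag of two: its graph is a shift over the product alphabet, and both coordinate projections are
injective letter-to-letter codes, whose inverses have bounded window by compactness.

A recognizable `f` gives the equivalence explicitly. A nonzero idempotent e = [u] with |u| ≥ k goes
to E = [f(u)]³, and s = [w] ∈ eSd goes to E[f(w)]D. The cubes are the main device: u can be repeated
without leaving its class, and the spare copies are the margins that desubstitution needs. Two facts
carry the rest. Words with equal contexts have images with equal contexts between margins
(`Recognizable.cls_lift_congr`), so choices do not matter. Desubstitutable words overlapping in v v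
v can be glued (`Locked.glue`) before the glued word is known to lie in L(X), so that nonzero images
come from nonzero words (`Recognizable.ne_zero_of_locked`). Functoriality, fullness and faithfulness
follow; essential surjectivity uses the periodic words.

On vertices the isomorphism is C(x)·e ↦ C(f(x))·E. A vertex is determined by the finite words
readable after x (`vertex_eq_iff`), so the same arguments give that it is well defined, injective
and natural; surjectivity desubstitutes longer and longer suffixes and takes a limit by compactness.
-/

theorem CategoryAction.Equivalent.refl (𝔸 : CategoryAction C P) : 𝔸.Equivalent 𝔸 :=
  ⟨⟨𝟭 C, ⟨fun _ _ => rfl⟩, 𝟙 𝔸.functor⟩, inferInstance,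
    show IsIso (𝟙 𝔸.functor) from inferInstance⟩

theorem CategoryAction.Equivalent.trans {𝔸 : CategoryAction C P} {𝔹 : CategoryAction D Q}
    {𝔼 : CategoryAction E R} (h : 𝔸.Equivalent 𝔹) (h' : 𝔹.Equivalent 𝔼) : 𝔸.Equivalent 𝔼 := by
  obtain ⟨⟨F, hF, η⟩, hFe, hη⟩ := h
  obtain ⟨⟨G, hG, θ⟩, hGe, hθ⟩ := h'
  dsimp only at hFe hGe hη hθ
  refine ⟨⟨F ⋙ G, inferInstance, η ≫ F.op.whiskerLeft θ⟩, inferInstance, ?_⟩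
  exact (inferInstance : IsIso (η ≫ F.op.whiskerLeft θ))

theorem CategoryAction.Equivalent.symm {𝔸 : CategoryAction C P} {𝔹 : CategoryAction D Q}
    (h : 𝔸.Equivalent 𝔹) : 𝔹.Equivalent 𝔸 := by
  obtain ⟨⟨F, hF, η⟩, hFe, hη⟩ := h
  dsimp only at hFe hη
  let i : F.inv.op ⋙ 𝔸.functor ≅ 𝔹.functor :=
    Functor.isoWhiskerLeft F.inv.op (asIso η) ≪≫
      Functor.isoWhiskerRight (NatIso.op F.asEquivalence.counitIso.symm) 𝔹.functor ≪≫
      Functor.isoWhiskerRight (Functor.opId D) 𝔹.functor ≪≫ 𝔹.functor.leftUnitor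
  refine ⟨⟨F.inv, inferInstance, i.inv⟩, inferInstance, ?_⟩
  exact (inferInstance : IsIso i.inv)

end Equivalent

/-! ### Words, blocks and suffixes of left-infinite sequences -/

section Words

variable {A : Type u}

@[simp] theorem length_block (x : ℤ → A) (i : ℤ) (n : ℕ) : (block x i n).length = n := by
  simp [block]

theorem getElem_block (x : ℤ → A) (i : ℤ) (n k : ℕ) (h : k < (block x i n).length) :
    (block x i n)[k] = x (i + k) := by
  simp [block]

theorem block_eq_iff {x z : ℤ → A} {i j : ℤ} {n : ℕ} :
    block x i n = block z j n ↔ ∀ k : ℕ, k < n → x (i + k) = z (j + k) := by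
  simp [block]

theorem block_shift (x : ℤ → A) (i j : ℤ) (n : ℕ) : block (shift j x) i n = block x (j + i) n := by
  simp [block, shift_apply, add_assoc]

theorem letters_ne_nil (u : FreeSemigroup A) : letters u ≠ [] := by simp [letters]

theorem letters_injective : Function.Injective (letters (A := A)) := by
  rintro ⟨a, u⟩ ⟨b, v⟩ h
  simpa [letters] using h

theorem exists_letters {l : List A} (h : l ≠ []) : ∃ u : FreeSemigroup A, letters u = l := by
  cases l with
  | nil => exact absurd rfl h
  | cons a l => exact ⟨⟨a, l⟩, rfl⟩

/-- The last `n` letters of a left-infinite sequence. -/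
def lastLetters (x : ℕ → A) : ℕ → List A
  | 0 => []
  | n + 1 => x n :: lastLetters x n

@[simp] theorem length_lastLetters (x : ℕ → A) (n : ℕ) : (lastLetters x n).length = n := by
  induction n with
  | zero => rfl
  | succ n ih => simp [lastLetters, ih]

theorem lastLetters_consSeq (x : ℕ → A) (a : A) (n : ℕ) :
    lastLetters (consSeq a x) (n + 1) = lastLetters x n ++ [a] := by
  induction n with
  | zero => rfl
  | succ n ih => rw [lastLetters, ih]; rfl

theorem lastLetters_appendWord (x : ℕ → A) (u : List A) (n : ℕ) :
    lastLetters (appendWord x u) (n + u.length) = lastLetters x n ++ u := by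
  induction u generalizing x n with
  | nil => simp [appendWord]
  | cons a u ih =>
    rw [appendWord, List.length_cons, show n + (u.length + 1) = (n + 1) + u.length by omega, ih,
      lastLetters_consSeq, List.append_assoc]
    rfl

theorem exists_lastLetters_eq_append (x : ℕ → A) {m n : ℕ} (h : m ≤ n) :
    ∃ l, lastLetters x n = l ++ lastLetters x m := by
  induction n, h using Nat.le_induction with
  | base => exact ⟨[], rfl⟩
  | succ n _ ih =>
    obtain ⟨l, hl⟩ := ih
    exact ⟨x n :: l, by rw [lastLetters, hl]; rfl⟩

theorem eq_of_lastLetters_eq {x x' : ℕ → A} (h : ∀ n, lastLetters x n = lastLetters x' n) :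
    x = x' := by
  funext n
  have := h (n + 1)
  simp only [lastLetters, List.cons.injEq] at this
  exact this.1

theorem lastLetters_eq_block (x y : ℕ → A) (n : ℕ) :
    block (joinSeq x y) (-n) n = lastLetters x n := by
  induction n with
  | zero => rfl
  | succ n ih =>
    have h : -((1 + n : ℕ) : ℤ) + ((1 : ℕ) : ℤ) = -n := by push_cast; ring
    have h' : -((1 + n : ℕ) : ℤ) = Int.negSucc n := by omega
    rw [lastLetters, ← ih, add_comm n 1, block_append, h, h']
    rfl

theorem block_joinSeq (x y : ℕ → A) (m n : ℕ) :
    block (joinSeq x y) (-m) (m + n) = lastLetters x m ++ (List.range n).map y := by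
  rw [block_append, lastLetters_eq_block, neg_add_cancel]
  have := block_joinSeq_prependWord x y [] n
  simp only [List.length_nil, zero_add, prependWord, List.nil_append] at this
  rw [this]

theorem range_map_prependWord (w : List A) (y : ℕ → A) (n : ℕ) :
    (List.range (w.length + n)).map (prependWord w y) = w ++ (List.range n).map y := by
  rw [← block_joinSeq_prependWord y y w n]
  refine List.map_congr_left fun k _ => ?_
  rw [zero_add]; rfl

theorem joinSeq_eq (z : ℤ → A) :
    joinSeq (fun n => z (Int.negSucc n)) (fun n => z (Int.ofNat n)) = z := by
  funext i
  cases i <;> rfl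

theorem exists_prependWord {y : ℕ → A} {w : List A} (h : (List.range w.length).map y = w) :
    ∃ z, y = prependWord w z := by
  induction w generalizing y with
  | nil => exact ⟨y, rfl⟩
  | cons a w ih =>
    rw [List.length_cons, List.range_succ_eq_map, List.map_cons, List.map_map, List.cons.injEq] at h
    obtain ⟨z, hz⟩ := ih (y := y ∘ Nat.succ) h.2
    refine ⟨z, ?_⟩
    rw [prependWord, ← hz, ← h.1]
    funext n
    cases n <;> rfl

end Words

/-! ### Languages, compactness, and vertices seen through finite words -/

namespace ShiftSpace

variable (X : ShiftSpace.{u})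

theorem mem_language_iff {w : List X.alphabet} :
    w ∈ X.language ↔ w ≠ [] ∧ ∃ x ∈ X.toSubshift.carrier, block x 0 w.length = w := by
  constructor
  · rintro ⟨x, hx, i, n, rfl⟩
    refine ⟨fun h => by simpa using congrArg List.length h, shift i x, X.toSubshift.mapsTo i hx, ?_⟩
    rw [block_shift, length_block, add_zero]
  · rintro ⟨h, x, hx, hw⟩
    have := List.length_pos_iff.2 h
    exact ⟨x, hx, 0, w.length - 1, by rw [Nat.sub_add_cancel this, hw]⟩

theorem block_mem_language {x : ℤ → X.alphabet} (hx : x ∈ X.toSubshift.carrier) (i : ℤ) {n : ℕ}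
    (hn : n ≠ 0) : block x i n ∈ X.language :=
  ⟨x, hx, i, n - 1, by rw [Nat.sub_add_cancel (Nat.pos_of_ne_zero hn)]⟩

variable {X}

theorem exists_block_eq {w : List X.alphabet} (h : w ∈ X.language) (i : ℤ) :
    ∃ x ∈ X.toSubshift.carrier, block x i w.length = w := by
  obtain ⟨-, x, hx, hw⟩ := X.mem_language_iff.1 h
  exact ⟨shift (-i) x, X.toSubshift.mapsTo _ hx, by rw [block_shift, neg_add_cancel, hw]⟩

theorem ne_nil_of_mem_language {w : List X.alphabet} (h : w ∈ X.language) : w ≠ [] :=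
  (X.mem_language_iff.1 h).1

theorem mem_language_of_append {p w q : List X.alphabet} (h : p ++ w ++ q ∈ X.language)
    (hw : w ≠ []) : w ∈ X.language := by
  obtain ⟨x, hx, e⟩ := exists_block_eq h 0
  rw [List.length_append, List.length_append, block_append, block_append] at e
  have h1 := (List.append_inj e (by simp)).1
  have h2 := (List.append_inj h1 (by simp)).2
  rw [← h2]
  exact X.block_mem_language hx _ (fun h => hw (List.length_eq_zero_iff.1 h))

theorem exists_append_mem_language {w : List X.alphabet} (h : w ∈ X.language) (m n : ℕ) :
    ∃ l r, l.length = m ∧ r.length = n ∧ l ++ w ++ r ∈ X.language := by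
  obtain ⟨x, hx, e⟩ := exists_block_eq h m
  refine ⟨block x 0 m, block x (0 + m + w.length) n, by simp, by simp, ?_⟩
  have : block x (0 + m) w.length = w := by rw [zero_add, e]
  have key : block x 0 m ++ w ++ block x (0 + m + w.length) n = block x 0 (m + w.length + n) := by
    rw [block_append, block_append, this, Nat.cast_add, add_assoc]
  rw [key]
  refine X.block_mem_language hx _ ?_
  have := List.length_pos_iff.2 (ne_nil_of_mem_language h)
  omega

theorem mem_of_block_mem_language {z : ℤ → X.alphabet}
    (h : ∀ n : ℕ, block z (-n) (n + (1 + n)) ∈ X.language) : z ∈ X.toSubshift.carrier := by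
  refine mem_of_windows X.toSubshift z 1 fun n => ?_
  obtain ⟨x, hx, e⟩ := exists_block_eq (h n) 0
  rw [length_block] at e
  exact ⟨x, hx, 0, e.symm⟩

/-- Every sequence of points has a cluster point. -/
theorem exists_cluster_point (p : ℕ → ℤ → X.alphabet) (hp : ∀ n, p n ∈ X.toSubshift.carrier) :
    ∃ q ∈ X.toSubshift.carrier, ∀ N : ℕ, ∃ n, N ≤ n ∧ ∀ i : ℤ, -(N : ℤ) ≤ i → i ≤ N →
      q i = p n i := by
  obtain ⟨q, hq, φ, hφ, hlim⟩ := X.toSubshift.isClosed.isCompact.tendsto_subseq hp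
  refine ⟨q, hq, fun N => ?_⟩
  have h1 : ∀ i ∈ Set.Icc (-(N : ℤ)) N, ∀ᶠ n in Filter.atTop, p (φ n) i = q i := by
    intro i _
    have := ((continuous_apply i).tendsto q).comp hlim
    rw [nhds_discrete, Filter.tendsto_pure] at this
    exact this
  have h2 := (Filter.eventually_all_finite (Set.finite_Icc (-(N : ℤ)) N)).2 h1
  obtain ⟨n, hn, hn'⟩ := (h2.and (Filter.eventually_ge_atTop N)).exists
  exact ⟨φ n, hn'.trans (hφ.id_le n), fun i hi hi' => (hn i ⟨hi, hi'⟩).symm⟩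

/-- The word `w` can be read after the left-infinite sequence `x`. -/
def Follows (x : ℕ → X.alphabet) (w : List X.alphabet) : Prop :=
  ∀ n, lastLetters x n ++ w ∈ X.language

theorem mem_C_iff {x y : ℕ → X.alphabet} :
    y ∈ X.C x ↔ ∀ n, Follows x ((List.range (n + 1)).map y) := by
  constructor
  · intro h n m
    rw [← block_joinSeq]
    exact X.block_mem_language h _ (by omega)
  · intro h
    refine mem_of_block_mem_language fun n => ?_
    rw [block_joinSeq, add_comm 1]
    exact h n n

theorem Follows.of_append {x : ℕ → X.alphabet} {w r : List X.alphabet} (h : Follows x (w ++ r))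
    (hw : w ≠ []) : Follows x w := fun n =>
  mem_language_of_append (p := []) (q := r) (by simpa using h n) (by simp [hw])

/-- The language is closed under nonempty factors, so arbitrarily long suffixes of `x` decide all of
them. -/
theorem follows_of_le {x : ℕ → X.alphabet} {w : List X.alphabet} (hw : w ≠ [])
    (h : ∀ n, ∃ m, n ≤ m ∧ lastLetters x m ++ w ∈ X.language) : Follows x w := by
  intro n
  obtain ⟨m, hm, h⟩ := h n
  obtain ⟨l, hl⟩ := exists_lastLetters_eq_append x hm
  rw [hl] at h
  exact mem_language_of_append (p := l) (q := []) (by simpa using h) (by simp [hw])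

theorem follows_appendWord {x : ℕ → X.alphabet} {u w : List X.alphabet} (hw : w ≠ []) :
    Follows (appendWord x u) w ↔ Follows x (u ++ w) := by
  constructor
  · intro h n
    rw [← List.append_assoc, ← lastLetters_appendWord]
    exact h _
  · intro h
    refine follows_of_le hw fun n => ⟨n + u.length, by omega, ?_⟩
    rw [lastLetters_appendWord, List.append_assoc]
    exact h n

theorem follows_of_joinSeq {x y : ℕ → X.alphabet} {w : List X.alphabet} (hw : w ≠ [])
    (h : joinSeq x (prependWord w y) ∈ X.toSubshift.carrier) : Follows x w := by
  have := mem_C_iff.1 h (w.length - 1)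
  rw [Nat.sub_add_cancel (List.length_pos_iff.2 hw)] at this
  have h2 := range_map_prependWord w y 0
  simp only [add_zero, List.range_zero, List.map_nil, List.append_nil] at h2
  rwa [h2] at this

/-- Compactness: points of X showing the last n letters of `x` and then `w` at the origin have a
cluster point, whose left half is `x` and whose right half begins with `w`. -/
theorem Follows.exists_joinSeq {x : ℕ → X.alphabet} {w : List X.alphabet} (h : Follows x w) :
    ∃ y, joinSeq x (prependWord w y) ∈ X.toSubshift.carrier := by
  choose p hp hpb using fun n : ℕ => exists_block_eq (h n) (-n)
  obtain ⟨q, hq, hqp⟩ := exists_cluster_point p hp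
  have key : ∀ n : ℕ, block q (-n) (n + w.length) = lastLetters x n ++ w := by
    intro n
    obtain ⟨m, hm, e⟩ := hqp (n + w.length)
    obtain ⟨k, rfl⟩ := Nat.exists_eq_add_of_le (show n ≤ m by omega)
    have h1 := hpb (n + k)
    obtain ⟨l, hl⟩ := exists_lastLetters_eq_append x (show n ≤ n + k by omega)
    have hlk := congrArg List.length hl
    simp only [length_lastLetters, List.length_append] at hlk
    rw [List.length_append, length_lastLetters, hl, show n + k + w.length = k + (n + w.length) by
      omega, block_append, List.append_assoc] at h1
    rw [← (List.append_inj h1 (by simp; omega)).2, block_eq_iff]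
    intro j hj
    rw [e _ (by omega) (by omega)]
    congr 1
    push_cast; ring
  have h0 : (List.range w.length).map (fun n => q (Int.ofNat n)) = w := by
    have := key 0
    simp only [lastLetters, List.nil_append, Nat.zero_add, Nat.cast_zero, neg_zero] at this
    conv_rhs => rw [← this]
    simp [block]
  obtain ⟨y, hy⟩ := exists_prependWord h0
  refine ⟨y, ?_⟩
  rw [← hy]
  have hx : x = fun n => q (Int.negSucc n) := by
    funext n
    have := key (n + 1)
    rw [lastLetters, show n + 1 + w.length = 1 + (n + w.length) by omega, block_append] at this
    simp only [block, List.range_one, List.map_cons, List.map_nil, List.cons_append,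
      List.cons.injEq] at this
    rw [← this.1]
    congr 1
  rw [hx, joinSeq_eq]
  exact hq

theorem Follows.exists_append {x : ℕ → X.alphabet} {w : List X.alphabet} (h : Follows x w)
    (hw : w ≠ []) (k : ℕ) : ∃ r, r.length = k ∧ Follows x (w ++ r) := by
  obtain ⟨y, hy⟩ := h.exists_joinSeq
  refine ⟨(List.range k).map y, by simp, ?_⟩
  have := mem_C_iff.1 hy (w.length + k - 1)
  have h1 := List.length_pos_iff.2 hw
  rwa [Nat.sub_add_cancel (by omega), range_map_prependWord] at this

/-- The class of a word in the syntactic semigroup. -/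
def cls (X : ShiftSpace.{u}) : FreeSemigroup X.alphabet →ₙ* X.S where
  toFun u := ((u : WithZero (FreeSemigroup X.alphabet)) : (syntacticCon X.language).Quotient)
  map_mul' _ _ := rfl

theorem cls_eq_iff {u v : FreeSemigroup X.alphabet} : X.cls u = X.cls v ↔
    ∀ p q, p ++ letters u ++ q ∈ X.language ↔ p ++ letters v ++ q ∈ X.language := by
  change ((u : WithZero (FreeSemigroup X.alphabet)) : (syntacticCon X.language).Quotient) =
    (v : WithZero (FreeSemigroup X.alphabet)) ↔ _
  rw [Con.eq]
  change context _ _ = context _ _ ↔ _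
  rw [Set.ext_iff]
  simp only [mem_context_coe, Prod.forall]

theorem cls_ne_zero_iff {u : FreeSemigroup X.alphabet} :
    X.cls u ≠ 0 ↔ letters u ∈ X.language := by
  have : X.cls u = 0 ↔ context X.language u = ∅ := by
    change ((u : WithZero (FreeSemigroup X.alphabet)) : (syntacticCon X.language).Quotient) =
      (0 : WithZero (FreeSemigroup X.alphabet)) ↔ _
    rw [Con.eq]
    change context _ _ = context _ _ ↔ _
    rw [context_zero]
  rw [Ne, this, ← Ne, ← Set.nonempty_iff_ne_empty]
  constructor
  · rintro ⟨p, hp⟩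
    exact mem_language_of_append (mem_context_coe.1 hp) (letters_ne_nil u)
  · intro h
    exact ⟨([], []), mem_context_coe.2 (by simpa using h)⟩

theorem exists_cls {s : X.S} (hs : s ≠ 0) : ∃ u, X.cls u = s := by
  induction s using Con.induction_on with
  | _ s =>
    cases s using WithZero.recZeroCoe with
    | zero => exact absurd rfl hs
    | coe u => exact ⟨u, rfl⟩

theorem act_vertex_cls (x : ℕ → X.alphabet) (u : FreeSemigroup X.alphabet) :
    X.kriegerAction.act (X.vertex x) (X.cls u) = X.vertex (appendWord x (letters u)) :=
  X.kriegerAction_vertex x u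

theorem vertex_ne_point_iff {x : ℕ → X.alphabet} : X.vertex x ≠ X.Q.point ↔ (X.C x).Nonempty := by
  rw [Set.nonempty_iff_ne_empty, Ne, Ne, not_iff_not]
  exact Subtype.ext_iff

theorem act_vertex_ne_point_iff {x : ℕ → X.alphabet} {u : FreeSemigroup X.alphabet} :
    X.kriegerAction.act (X.vertex x) (X.cls u) ≠ X.Q.point ↔ Follows x (letters u) := by
  rw [act_vertex_cls, vertex_ne_point_iff]
  constructor
  · rintro ⟨y, hy⟩
    exact follows_of_joinSeq (letters_ne_nil u)
      ((mem_futures_appendWord X.toSubshift (letters u) x y).1 hy)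
  · intro h
    obtain ⟨y, hy⟩ := h.exists_joinSeq
    exact ⟨y, (mem_futures_appendWord X.toSubshift (letters u) x y).2 hy⟩

/-- By `mem_C_iff` a future is determined by its finite prefixes. Comparing vertices thus becomes a
question about finite words, to which desubstitution applies. -/
theorem vertex_eq_iff {x x' : ℕ → X.alphabet} : X.vertex x = X.vertex x' ↔
    ∀ w : FreeSemigroup X.alphabet, Follows x (letters w) ↔ Follows x' (letters w) := by
  constructor
  · intro h w
    rw [← act_vertex_ne_point_iff, h, act_vertex_ne_point_iff]
  · intro h
    refine Subtype.ext (Set.ext fun y => ?_)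
    refine mem_C_iff.trans (Iff.trans (forall_congr' fun n => ?_) mem_C_iff.symm)
    obtain ⟨w, hw⟩ := exists_letters (l := (List.range (n + 1)).map y) (by simp)
    rw [← hw, h]

theorem exists_vertex {q : X.Q} (hq : q ≠ X.Q.point) : ∃ x, X.vertex x = q := by
  obtain ⟨q, ⟨x, rfl⟩ | h⟩ := q
  · exact ⟨x, rfl⟩
  · exact absurd (Subtype.ext (Set.mem_singleton_iff.1 h)) hq

end ShiftSpace

/-! ### Nonerasing substitutions and powers of words -/

section Substitution

variable {A B : Type u}

/-- The image of a word under the substitution sending the letter `a` to the word `f a`. -/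
def substWord (f : A → FreeSemigroup B) (w : List A) : List B := w.flatMap fun a => letters (f a)

variable (f : A → FreeSemigroup B)

@[simp] theorem substWord_nil : substWord f [] = [] := rfl

@[simp] theorem substWord_cons (a : A) (w : List A) :
    substWord f (a :: w) = letters (f a) ++ substWord f w := rfl

@[simp] theorem substWord_append (v w : List A) :
    substWord f (v ++ w) = substWord f v ++ substWord f w := List.flatMap_append

theorem length_le_length_substWord (w : List A) : w.length ≤ (substWord f w).length := by
  induction w with
  | nil => simp
  | cons a w ih =>
    have := List.length_pos_iff.2 (letters_ne_nil (f a))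
    rw [substWord_cons, List.length_append, List.length_cons]
    omega

theorem substWord_eq_nil_iff {w : List A} : substWord f w = [] ↔ w = [] := by
  refine ⟨fun h => ?_, fun h => h ▸ rfl⟩
  have := length_le_length_substWord f w
  rw [h] at this
  simpa using this

/-- Two prefixes of one word are comparable, and since no letter is erased, equal images leave
nothing between them. This aligns two desubstitutions of the same word. -/
theorem append_inj_of_substWord_eq {a b c d : List A} (h : a ++ b = c ++ d)
    (hf : substWord f a = substWord f c) : a = c ∧ b = d := by
  have key : ∀ {a c e : List A}, a = c ++ e → substWord f a = substWord f c → e = [] := by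
    rintro a c e rfl he
    exact (substWord_eq_nil_iff f).1 (List.length_eq_zero_iff.1
      (by simpa using congrArg List.length he))
  rcases List.append_eq_append_iff.1 h with ⟨e, rfl, rfl⟩ | ⟨e, rfl, rfl⟩
  · obtain rfl := key rfl hf.symm
    simp
  · obtain rfl := key rfl hf
    simp

theorem letters_lift (w : FreeSemigroup A) :
    letters (FreeSemigroup.lift f w) = substWord f (letters w) := by
  induction w using FreeSemigroup.recOnMul with
  | ih1 a => rw [FreeSemigroup.lift_of]; exact (List.append_nil _).symm
  | ih2 a w ih ih' => rw [map_mul, letters_mul, letters_mul, ih, ih', substWord_append]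

/-- The power `u ^ (n + 1)` of a nonempty word. -/
def wordPow (u : FreeSemigroup A) : ℕ → FreeSemigroup A
  | 0 => u
  | n + 1 => wordPow u n * u

theorem wordPow_mul (u : FreeSemigroup A) (m n : ℕ) :
    wordPow u m * wordPow u n = wordPow u (m + n + 1) := by
  induction n with
  | zero => rfl
  | succ n ih => rw [wordPow, ← mul_assoc, ih]; rfl

theorem wordPow_wordPow (u : FreeSemigroup A) (m n : ℕ) :
    wordPow (wordPow u m) n = wordPow u (m * n + m + n) := by
  induction n with
  | zero => simp [wordPow]
  | succ n ih => rw [wordPow, ih, wordPow_mul]; congr 1; ring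

theorem le_length_wordPow (u : FreeSemigroup A) (n : ℕ) : n + 1 ≤ (wordPow u n).length := by
  induction n with
  | zero => simp [wordPow, FreeSemigroup.length]
  | succ n ih => rw [wordPow, FreeSemigroup.length_mul]; simp [FreeSemigroup.length] at ih ⊢; omega

theorem length_letters (u : FreeSemigroup A) : (letters u).length = u.length := rfl

end Substitution

/-! ### Recognizable substitutions: locking and gluing -/

open ShiftSpace

variable {X Y : ShiftSpace.{u}}

/-- A substitution `f` such that the language of `Y` is the factorial closure of the image of the
language of `X`, and such that images under `f` of words of `X` can be desubstituted unambiguously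
away from margins of length `k`. -/
structure Recognizable (X Y : ShiftSpace.{u}) (f : X.alphabet → FreeSemigroup Y.alphabet)
    (k : ℕ) : Prop where
  mem : ∀ w ∈ X.language, substWord f w ∈ Y.language
  exists_factor : ∀ w ∈ Y.language, ∃ v ∈ X.language, ∃ s t, substWord f v = s ++ w ++ t
  desubst : ∀ p z q v s t, z ≠ [] → k ≤ p.length → k ≤ q.length → p ++ z ++ q ∈ X.language →
    v ∈ X.language → substWord f v = s ++ substWord f (p ++ z ++ q) ++ t →
    ∃ v₁ v₂, v = v₁ ++ z ++ v₂ ∧ substWord f v₁ = s ++ substWord f p ∧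
      substWord f v₂ = substWord f q ++ t
  periodic : ∀ r : FreeSemigroup Y.alphabet, (∀ n, letters (wordPow r n) ∈ Y.language) →
    ∃ (u : FreeSemigroup X.alphabet) (r₁ r₂ : List Y.alphabet), letters r = r₁ ++ r₂ ∧
      substWord f (letters u) = r₂ ++ r₁ ∧ ∀ n, letters (wordPow u n) ∈ X.language

/-- In every word of `X` whose image contains the image of `p z q`, the corresponding occurrence of
the image of `z` comes from an occurrence of `z`. -/
def Locked (X : ShiftSpace.{u}) {B : Type u} (f : X.alphabet → FreeSemigroup B)
    (p z q : List X.alphabet) : Prop :=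
  ∀ v ∈ X.language, ∀ s t, substWord f v = s ++ substWord f (p ++ z ++ q) ++ t →
    ∃ v₁ v₂, v = v₁ ++ z ++ v₂ ∧ substWord f v₁ = s ++ substWord f p ∧
      substWord f v₂ = substWord f q ++ t

/-- The first locking finds `z₁ m₁ m` in `v`. The second, applied to the part of `v` starting at
`m₁`, finds `m m₂ z₂`, and the occurrences are aligned because what precedes `m` has image f(m₁) in
both. The glued word is not assumed to lie in the language, which allows deducing that it does. -/
theorem Locked.glue {B : Type u} {f : X.alphabet → FreeSemigroup B}
    {p z₁ m₁ m m₂ z₂ q : List X.alphabet} (h₁ : Locked X f p (z₁ ++ m₁ ++ m) m₂)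
    (h₂ : Locked X f m₁ (m ++ m₂ ++ z₂) q) (hm : m ≠ []) :
    Locked X f p (z₁ ++ m₁ ++ m ++ m₂ ++ z₂) q := by
  intro v hv s t e
  obtain ⟨v₁, v₂, rfl, e₁, e₂⟩ := h₁ v hv s (substWord f z₂ ++ substWord f q ++ t)
    (by rw [e]; simp)
  have hv' : m₁ ++ m ++ v₂ ∈ X.language :=
    mem_language_of_append (p := v₁ ++ z₁) (q := []) (by simpa using hv) (by simp [hm])
  obtain ⟨v₃, v₄, e₃, e₄, e₅⟩ := h₂ _ hv' [] t (by simp [e₂])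
  rw [List.append_assoc, List.append_assoc v₃] at e₃
  obtain ⟨rfl, e₆⟩ := append_inj_of_substWord_eq f e₃ (by simpa using e₄.symm)
  rw [List.append_assoc m, List.append_assoc m, List.append_right_inj] at e₆
  exact ⟨v₁, v₄, by rw [e₆]; simp, e₁, e₅⟩

namespace Recognizable

variable {f : X.alphabet → FreeSemigroup Y.alphabet} {k : ℕ} (R : Recognizable X Y f k)

include R

theorem locked {p z q : List X.alphabet} (hz : z ≠ []) (hp : k ≤ p.length) (hq : k ≤ q.length)
    (h : p ++ z ++ q ∈ X.language) : Locked X f p z q :=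
  fun v hv s t e => R.desubst p z q v s t hz hp hq h hv e

theorem cls_lift_ne_zero {w : FreeSemigroup X.alphabet} (h : X.cls w ≠ 0) :
    Y.cls (FreeSemigroup.lift f w) ≠ 0 := by
  rw [cls_ne_zero_iff] at h ⊢
  rw [letters_lift]
  exact R.mem _ h

/-- In the overlap v v v, the last copy is the right margin of the first piece, the first copy is
the left margin of the second, and the middle copy is what they share. -/
theorem locked_glue {p z₁ v z₂ q : FreeSemigroup X.alphabet} (hp : k ≤ p.length)
    (hv : k ≤ v.length) (hq : k ≤ q.length) (h₁ : X.cls (p * z₁ * v * v * v) ≠ 0)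
    (h₂ : X.cls (v * v * v * z₂ * q) ≠ 0) :
    Locked X f (letters p) (letters (z₁ * v * v * v * z₂)) (letters q) := by
  rw [cls_ne_zero_iff] at h₁ h₂
  simp only [letters_mul] at h₁ h₂ ⊢
  refine Locked.glue (R.locked ?_ hp hv ?_) (R.locked ?_ hv hq ?_) (letters_ne_nil v)
  · simp [letters_ne_nil]
  · simpa using h₁
  · simp [letters_ne_nil]
  · simpa using h₂

/-- A word of Y occurs in the image of some word of X, and locking exhibits `z` inside the latter.
-/
theorem ne_zero_of_locked {p z q : FreeSemigroup X.alphabet}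
    (h : Locked X f (letters p) (letters z) (letters q))
    (hY : Y.cls (FreeSemigroup.lift f (p * z * q)) ≠ 0) : X.cls z ≠ 0 := by
  rw [cls_ne_zero_iff] at hY ⊢
  obtain ⟨v, hv, s, t, e⟩ := R.exists_factor _ hY
  rw [letters_lift, letters_mul, letters_mul] at e
  obtain ⟨v₁, v₂, rfl, -, -⟩ := h v hv s t e
  exact mem_language_of_append hv (letters_ne_nil z)

/-- Words with the same contexts have images with the same contexts, within margins. -/
theorem cls_lift_congr {p w w' q : FreeSemigroup X.alphabet} (hp : k ≤ p.length)
    (hq : k ≤ q.length) (hw : X.cls w = X.cls w') (h : X.cls (p * w * q) ≠ 0) :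
    Y.cls (FreeSemigroup.lift f (p * w * q)) = Y.cls (FreeSemigroup.lift f (p * w' * q)) := by
  have key : ∀ w w' : FreeSemigroup X.alphabet, X.cls w = X.cls w' → X.cls (p * w * q) ≠ 0 →
      ∀ s t, s ++ letters (FreeSemigroup.lift f (p * w * q)) ++ t ∈ Y.language →
        s ++ letters (FreeSemigroup.lift f (p * w' * q)) ++ t ∈ Y.language := by
    intro w w' hw h s t hY
    rw [cls_ne_zero_iff, letters_mul, letters_mul] at h
    obtain ⟨v, hv, s', t', e⟩ := R.exists_factor _ hY
    rw [letters_lift, letters_mul, letters_mul] at e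
    obtain ⟨v₁, v₂, rfl, e₁, e₂⟩ := R.locked (p := letters p) (q := letters q) (letters_ne_nil w)
      hp hq h v hv (s' ++ s) (t ++ t')
      (by rw [e]; simp)
    -- Exchanging w for w' inside the desubstituted word stays in L(X), and leaves the images of
    -- both sides unchanged.
    have := R.mem _ ((cls_eq_iff.1 hw v₁ v₂).1 hv)
    rw [substWord_append, substWord_append, e₁, e₂] at this
    refine mem_language_of_append (p := s') (q := t') ?_ (by simp [letters_ne_nil])
    rw [letters_lift, letters_mul, letters_mul]
    simpa using this
  refine cls_eq_iff.2 fun s t => ⟨key w w' hw h s t, key w' w hw.symm ?_ s t⟩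
  rwa [map_mul, map_mul, ← hw, ← map_mul, ← map_mul]

omit R in
-- Every word of X extends in both directions, so it suffices to compare contexts that are nonempty
-- and surrounded by further margins, which give room for locking.
theorem mem_of_margins {w w' : FreeSemigroup X.alphabet}
    (h : ∀ p' p q q' : FreeSemigroup X.alphabet, k ≤ p'.length → k ≤ q'.length →
      X.cls (p' * (p * w * q) * q') ≠ 0 → X.cls (p * w' * q) ≠ 0) (p q : List X.alphabet)
    (hw : p ++ letters w ++ q ∈ X.language) : p ++ letters w' ++ q ∈ X.language := by
  -- One letter on each side makes the context nonempty. The margins have length `k + 1` rather than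
  -- `k`, to be nonempty also when k = 0.
  obtain ⟨l, r, hl, hr, h₁⟩ := exists_append_mem_language hw 1 1
  obtain ⟨l', r', hl', hr', h₂⟩ := exists_append_mem_language h₁ (k + 1) (k + 1)
  obtain ⟨p₁, e₁⟩ := exists_letters (l := l ++ p)
    (List.ne_nil_of_length_pos (by rw [List.length_append]; omega))
  obtain ⟨q₁, e₂⟩ := exists_letters (l := q ++ r)
    (List.ne_nil_of_length_pos (by rw [List.length_append]; omega))
  obtain ⟨p₂, rfl⟩ := exists_letters (l := l') (List.ne_nil_of_length_pos (by omega))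
  obtain ⟨q₂, rfl⟩ := exists_letters (l := r') (List.ne_nil_of_length_pos (by omega))
  rw [length_letters] at hl' hr'
  have := h p₂ p₁ q₁ q₂ (by omega) (by omega) (cls_ne_zero_iff.2 (by
    simp only [letters_mul, e₁, e₂]; simpa using h₂))
  rw [cls_ne_zero_iff, letters_mul, letters_mul, e₁, e₂] at this
  exact mem_language_of_append (p := l) (q := r) (by simpa using this) (by simp [letters_ne_nil])

/-- Used contrapositively: a zero product in S(X) has zero image. The outer copies of `u` and `z`
are the margins of two pieces glued along v v v. -/
theorem cls_mul_ne_zero {u w v w' z : FreeSemigroup X.alphabet} (hu : k ≤ u.length)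
    (hv : k ≤ v.length) (hz : k ≤ z.length) (h₁ : X.cls (u * u * w * v * v * v) ≠ 0)
    (h₂ : X.cls (v * v * v * w' * z * z) ≠ 0)
    (hY : Y.cls (FreeSemigroup.lift f (u * u * w * v * v * v * w' * z * z)) ≠ 0) :
    X.cls (w * v * v * v * w') ≠ 0 := by
  have := R.ne_zero_of_locked (R.locked_glue (p := u) (z₁ := u * w) (z₂ := w' * z) (q := z) hu hv hz
    (by simpa only [mul_assoc] using h₁) (by simpa only [mul_assoc] using h₂))
    (by simpa only [mul_assoc] using hY)
  rw [cls_ne_zero_iff, letters_mul, letters_mul] at *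
  simp only [letters_mul] at this ⊢
  exact mem_language_of_append (p := letters u) (q := letters z) (by simpa using this)
    (by simp [letters_ne_nil])

/-- Source of fullness. In a word of X whose image contains f(u³) r f(v³), the middle `u` and the
middle `v` are locked; `m` is what stands between them. -/
theorem exists_lift_eq {u v : FreeSemigroup X.alphabet} {r : FreeSemigroup Y.alphabet}
    (hu : k ≤ u.length) (hv : k ≤ v.length) (hu' : X.cls (u * u * u) ≠ 0)
    (hv' : X.cls (v * v * v) ≠ 0)
    (h : Y.cls (FreeSemigroup.lift f (u * u * u) * r * FreeSemigroup.lift f (v * v * v)) ≠ 0) :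
    ∃ m, X.cls (u * m * v) ≠ 0 ∧
      FreeSemigroup.lift f m = FreeSemigroup.lift f u * r * FreeSemigroup.lift f v := by
  rw [cls_ne_zero_iff] at *
  obtain ⟨x, hx, s, t, e⟩ := R.exists_factor _ h
  simp only [letters_mul, letters_lift] at *
  obtain ⟨x₁, x₂, rfl, e₁, e₂⟩ := R.locked (p := letters u) (q := letters u) (letters_ne_nil u)
    hu hu hu' x hx s
    (letters r ++ substWord f (letters v ++ letters v ++ letters v) ++ t) (by rw [e]; simp)
  have hx₂ : x₂ ≠ [] := by
    rintro rfl
    simpa [letters_ne_nil] using e₂.symm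
  obtain ⟨x₃, x₄, rfl, e₃, e₄⟩ := R.locked (p := letters v) (q := letters v) (letters_ne_nil v)
    hv hv hv' x₂
    (mem_language_of_append (p := x₁ ++ letters u) (q := []) (by simpa using hx) hx₂)
    (substWord f (letters u) ++ letters r) t (by rw [e₂]; simp)
  have hx₃ : x₃ ≠ [] := by
    rintro rfl
    simpa [letters_ne_nil] using e₃.symm
  obtain ⟨m, rfl⟩ := exists_letters hx₃
  refine ⟨m, ?_, letters_injective ?_⟩
  · rw [cls_ne_zero_iff, letters_mul, letters_mul]
    exact mem_language_of_append (p := x₁) (q := x₄) (by simpa using hx) (by simp [letters_ne_nil])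
  · rw [letters_lift, e₃, letters_mul, letters_mul, letters_lift, letters_lift]

end Recognizable

/-! ### The functor between Karoubi envelopes: well defined, full and faithful -/

theorem cls_wordPow {u : FreeSemigroup X.alphabet} (hu : IsIdempotentElem (X.cls u)) (n : ℕ) :
    X.cls (wordPow u n) = X.cls u := by
  induction n with
  | zero => rfl
  | succ n ih => rw [wordPow, map_mul, ih, hu]

/-- Powers of a representative of an idempotent stay in its class, so representatives can serve as
margins. -/
theorem exists_idemWord (k : ℕ) (e : X.𝕂) (he : e.idem ≠ 0) :
    ∃ u, X.cls u = e.idem ∧ k ≤ u.length := by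
  obtain ⟨u, hu⟩ := exists_cls he
  exact ⟨wordPow u k, by rw [cls_wordPow (hu ▸ e.isIdem), hu],
    (Nat.le_succ k).trans (le_length_wordPow u k)⟩

open Classical in
/-- The idempotent `[f(u)]³` of `S(Y)`, where `u` is a word of length at least `k` in the class of a
nonzero idempotent of `S(X)`; the idempotent `0` is sent to `0`. -/
noncomputable def imageIdem (f : X.alphabet → FreeSemigroup Y.alphabet) (k : ℕ) (e : X.𝕂) : Y.S :=
  if he : e.idem = 0 then 0 else
    Y.cls (FreeSemigroup.lift f ((exists_idemWord k e he).choose *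
      (exists_idemWord k e he).choose * (exists_idemWord k e he).choose))

open Classical in
/-- The element of `S(Y)` obtained from a nonzero element `s ∈ eSf` of `S(X)` by applying the
substitution to a word in the class `s`, and multiplying by the images of `e` and `f`. -/
noncomputable def imageHom (f : X.alphabet → FreeSemigroup Y.alphabet) (k : ℕ) {e d : X.𝕂}
    (s : Karoubi.Hom d e) : Y.S :=
  if hs : s.val = 0 then 0 else
    imageIdem f k e * Y.cls (FreeSemigroup.lift f (exists_cls hs).choose) * imageIdem f k d

theorem imageIdem_of_eq_zero (f : X.alphabet → FreeSemigroup Y.alphabet) (k : ℕ) {e : X.𝕂}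
    (he : e.idem = 0) : imageIdem f k e = 0 := dif_pos he

theorem exists_imageIdem_eq (f : X.alphabet → FreeSemigroup Y.alphabet) (k : ℕ) {e : X.𝕂}
    (he : e.idem ≠ 0) : ∃ u, X.cls u = e.idem ∧ k ≤ u.length ∧
      imageIdem f k e = Y.cls (FreeSemigroup.lift f (u * u * u)) :=
  ⟨_, (exists_idemWord k e he).choose_spec.1, (exists_idemWord k e he).choose_spec.2, dif_neg he⟩

theorem Karoubi.Hom.source_ne_zero {S : Type u} [SemigroupWithZero S] {d e : Karoubi S}
    {s : Karoubi.Hom d e} (hs : s.val ≠ 0) : d.idem ≠ 0 := fun h => hs (by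
  rw [← s.mul_right, h, mul_zero])

theorem Karoubi.Hom.target_ne_zero {S : Type u} [SemigroupWithZero S] {d e : Karoubi S}
    {s : Karoubi.Hom d e} (hs : s.val ≠ 0) : e.idem ≠ 0 := fun h => hs (by
  rw [← s.left_mul, h, zero_mul])

namespace Recognizable

variable {f : X.alphabet → FreeSemigroup Y.alphabet} {k : ℕ} (R : Recognizable X Y f k)

include R

/-- Between two copies of `u` any representative of the idempotent may be replaced by `u`. In
particular all powers of f(u) with exponent at least 3 have the class of the cube. -/
theorem cls_lift_mul_mul {u w : FreeSemigroup X.alphabet} (hk : k ≤ u.length)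
    (hu : IsIdempotentElem (X.cls u)) (hu0 : X.cls u ≠ 0) (hw : X.cls w = X.cls u) :
    Y.cls (FreeSemigroup.lift f (u * w * u)) = Y.cls (FreeSemigroup.lift f (u * u * u)) :=
  R.cls_lift_congr hk hk hw (by rwa [map_mul, map_mul, hw, hu, hu])

theorem isIdempotentElem_imageIdem (e : X.𝕂) : IsIdempotentElem (imageIdem f k e) := by
  by_cases he : e.idem = 0
  · rw [imageIdem_of_eq_zero f k he]
    exact mul_zero 0
  · obtain ⟨u, hu, hk, h⟩ := exists_imageIdem_eq f k he
    have hi : IsIdempotentElem (X.cls u) := hu ▸ e.isIdem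
    rw [IsIdempotentElem, h, ← map_mul, ← map_mul]
    -- The square of the cube is the class of f(u · u⁴ · u), and u⁴ is in the class of u.
    have := R.cls_lift_mul_mul hk hi (hu ▸ he) (w := u * u * u * u) (by simp only [map_mul, hi.eq])
    simpa only [mul_assoc] using this

omit R in
theorem imageHom_of_eq_zero {e d : X.𝕂} {s : Karoubi.Hom d e} (hs : s.val = 0) :
    imageHom f k s = 0 := dif_pos hs

/-- The flanking cubes are margins around `w`, so the chosen representative of `s` does not matter.
-/
theorem imageHom_eq {e d : X.𝕂} {s : Karoubi.Hom d e} (hs : s.val ≠ 0)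
    {w : FreeSemigroup X.alphabet} (hw : X.cls w = s.val) :
    imageHom f k s = imageIdem f k e * Y.cls (FreeSemigroup.lift f w) * imageIdem f k d := by
  obtain ⟨u, hu, hk, h⟩ := exists_imageIdem_eq f k (Karoubi.Hom.target_ne_zero hs)
  obtain ⟨v, hv, hk', h'⟩ := exists_imageIdem_eq f k (Karoubi.Hom.source_ne_zero hs)
  rw [imageHom, dif_neg hs, h, h']
  simp only [← map_mul (f := Y.cls), ← map_mul (f := FreeSemigroup.lift f)]
  refine R.cls_lift_congr ?_ ?_ ((exists_cls hs).choose_spec.trans hw.symm) ?_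
  · simp only [FreeSemigroup.length_mul]; omega
  · simp only [FreeSemigroup.length_mul]; omega
  · rw [map_mul, map_mul, (exists_cls hs).choose_spec]
    simp only [map_mul, hu, hv, e.isIdem.eq, d.isIdem.eq, s.mem]
    exact hs

theorem imageIdem_mul_imageHom {e d : X.𝕂} (s : Karoubi.Hom d e) :
    imageIdem f k e * imageHom f k s * imageIdem f k d = imageHom f k s := by
  by_cases hs : s.val = 0
  · rw [imageHom_of_eq_zero hs, mul_zero, zero_mul]
  · obtain ⟨w, hw⟩ := exists_cls hs
    rw [R.imageHom_eq hs hw, ← mul_assoc, ← mul_assoc, R.isIdempotentElem_imageIdem e, mul_assoc,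
      R.isIdempotentElem_imageIdem d]

theorem imageHom_id (e : X.𝕂) :
    imageHom f k (⟨e.idem, by rw [e.isIdem, e.isIdem]⟩ : Karoubi.Hom e e) = imageIdem f k e := by
  by_cases he : e.idem = 0
  · rw [imageHom_of_eq_zero he, imageIdem_of_eq_zero f k he]
  · obtain ⟨u, hu, hk, h⟩ := exists_imageIdem_eq f k he
    have hi : IsIdempotentElem (X.cls u) := hu ▸ e.isIdem
    rw [R.imageHom_eq he hu, h, ← map_mul, ← map_mul, ← map_mul, ← map_mul]
    have := R.cls_lift_mul_mul hk hi (hu ▸ he) (w := u * u * u * u * u)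
      (by simp only [map_mul, hi.eq])
    simpa only [mul_assoc] using this

/-- The inner idempotent D = [f(v³)] turns the product of the images into the image of w v v v w', a
representative of the product when this is nonzero. When it is zero, `cls_mul_ne_zero` shows that
the images multiply to zero as well. -/
theorem imageHom_mul {c d e : X.𝕂} (s : Karoubi.Hom d e) (t : Karoubi.Hom c d)
    (st : Karoubi.Hom c e) (hst : st.val = s.val * t.val) :
    imageHom f k st = imageHom f k s * imageHom f k t := by
  by_cases hs : s.val = 0
  · rw [imageHom_of_eq_zero hs, imageHom_of_eq_zero (by rw [hst, hs, zero_mul]), zero_mul]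
  by_cases ht : t.val = 0
  · rw [imageHom_of_eq_zero ht, imageHom_of_eq_zero (by rw [hst, ht, mul_zero]), mul_zero]
  obtain ⟨w, hw⟩ := exists_cls hs
  obtain ⟨w', hw'⟩ := exists_cls ht
  obtain ⟨u, hu, hku, h₁⟩ := exists_imageIdem_eq f k (Karoubi.Hom.target_ne_zero hs)
  obtain ⟨v, hv, hkv, h₂⟩ := exists_imageIdem_eq f k (Karoubi.Hom.source_ne_zero hs)
  obtain ⟨z, hz, hkz, h₃⟩ := exists_imageIdem_eq f k (Karoubi.Hom.source_ne_zero ht)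
  have hmid : X.cls (w * v * v * v * w') = st.val := by
    simp only [map_mul, hw, hw', hv, s.mul_right, hst]
  have hY : imageHom f k s * imageHom f k t =
      imageIdem f k e * Y.cls (FreeSemigroup.lift f (w * v * v * v * w')) * imageIdem f k c := by
    rw [R.imageHom_eq hs hw, R.imageHom_eq ht hw']
    calc _ = imageIdem f k e * Y.cls (FreeSemigroup.lift f w) *
            (imageIdem f k d * imageIdem f k d) * Y.cls (FreeSemigroup.lift f w') *
            imageIdem f k c := by simp only [mul_assoc]
      _ = _ := by
        rw [R.isIdempotentElem_imageIdem d, h₂]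
        simp only [map_mul, mul_assoc]
  by_cases h0 : st.val = 0
  · rw [imageHom_of_eq_zero h0, hY]
    by_contra hne
    refine R.cls_mul_ne_zero (u := u) (w := w) (w' := w') hku hkv hkz ?_ ?_ (fun h => hne ?_)
      (hmid.trans h0)
    · simpa only [map_mul, hu, hv, hw, e.isIdem.eq, s.left_mul, s.mul_right] using hs
    · simpa only [map_mul, hz, hv, hw', d.isIdem.eq, t.left_mul, t.mul_right] using ht
    · rw [h₁, h₃, ← map_mul, ← map_mul, ← map_mul, ← map_mul, show u * u * u *
        (w * v * v * v * w') * (z * z * z) = u * (u * u * w * v * v * v * w' * z * z) * z by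
          simp only [mul_assoc], map_mul, map_mul, map_mul, map_mul, h, mul_zero, zero_mul]
  · rw [hY, R.imageHom_eq h0 hmid]

/-- Two gluings, along u u u and along v v v. Only the three overlapping pieces have to be words of
X, not the whole. -/
theorem locked_glue_two {p' p u w v q q' : FreeSemigroup X.alphabet} (hp' : k ≤ p'.length)
    (hu : k ≤ u.length) (hv : k ≤ v.length) (hq' : k ≤ q'.length)
    (h₁ : X.cls (p' * p * u * u * u) ≠ 0) (h₂ : X.cls (u * u * u * w * v * v * v) ≠ 0)
    (h₃ : X.cls (v * v * v * q * q') ≠ 0) :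
    Locked X f (letters p') (letters (p * u * u * u * w * v * v * v * q)) (letters q') := by
  have h₄ := R.locked_glue (z₂ := w * v * v) hp' hu hv h₁ (by simpa only [mul_assoc] using h₂)
  have h₅ : Locked X f (letters v) (letters v ++ letters v ++ letters q) (letters q') := by
    refine R.locked (by simp [letters_ne_nil]) hv hq' ?_
    rw [cls_ne_zero_iff] at h₃
    simpa [letters_mul] using h₃
  have h₆ := Locked.glue (z₁ := letters (p * u * u * u * w)) (by simpa [letters_mul] using h₄) h₅
    (letters_ne_nil v)
  simpa [letters_mul] using h₆

/-- Source of faithfulness. Since u³wv³ has the class of `w`, a context of `w` yields a nonzero word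
with nonzero image; equality of classes in S(Y) puts `w'` in place of `w` in that image; the double
gluing pulls the result back to L(X), with u³w'v³ as middle piece. -/
theorem mem_of_cls_lift_eq {u v w w' : FreeSemigroup X.alphabet} (hku : k ≤ u.length)
    (hkv : k ≤ v.length) (hu : IsIdempotentElem (X.cls u)) (hv : IsIdempotentElem (X.cls v))
    (hw : X.cls u * X.cls w * X.cls v = X.cls w) (hw' : X.cls u * X.cls w' * X.cls v = X.cls w')
    (hw0 : X.cls w' ≠ 0) (h : Y.cls (FreeSemigroup.lift f (u * u * u * w * v * v * v)) =
      Y.cls (FreeSemigroup.lift f (u * u * u * w' * v * v * v))) (p q : List X.alphabet)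
    (hpq : p ++ letters w ++ q ∈ X.language) : p ++ letters w' ++ q ∈ X.language := by
  have hex : ∀ w : FreeSemigroup X.alphabet, X.cls u * X.cls w * X.cls v = X.cls w →
      X.cls (u * u * u * w * v * v * v) = X.cls w := by
    intro w hw
    calc _ = (X.cls u * X.cls u * X.cls u) * X.cls w * (X.cls v * X.cls v * X.cls v) := by
          simp only [map_mul, mul_assoc]
      _ = _ := by rw [hu, hu, hv, hv, hw]
  refine mem_of_margins (k := k) (fun p' p q q' hp' hq' h0 => ?_) p q hpq
  have h1 : X.cls (p' * (p * (u * u * u * w * v * v * v) * q) * q') ≠ 0 := by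
    simpa only [map_mul, mul_assoc] using (by
      rwa [map_mul, map_mul, map_mul, map_mul, hex w hw, ← map_mul, ← map_mul, ← map_mul,
        ← map_mul] : X.cls (p' * (p * (u * u * u * w * v * v * v) * q) * q') ≠ 0)
  have hl : ∀ a b : FreeSemigroup X.alphabet, X.cls (a * b) ≠ 0 → X.cls a ≠ 0 := by
    intro a b h h'
    rw [map_mul, h', zero_mul] at h
    exact h rfl
  have hr : ∀ a b : FreeSemigroup X.alphabet, X.cls (a * b) ≠ 0 → X.cls b ≠ 0 := by
    intro a b h h'
    rw [map_mul, h', mul_zero] at h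
    exact h rfl
  have h2 := R.ne_zero_of_locked (R.locked_glue_two (w := w') (p := p) (q := q) hp' hku hkv hq'
    (hl _ (w * v * v * v * q * q') (by simpa only [mul_assoc] using h1)) (by rwa [hex w' hw'])
    (hr (p' * p * u * u * u * w) _ (by simpa only [mul_assoc] using h1))) (by
      have h3 := R.cls_lift_ne_zero h1
      rw [map_mul, map_mul, map_mul, map_mul, map_mul, map_mul, map_mul, map_mul, h, ← map_mul,
        ← map_mul, ← map_mul, ← map_mul, ← map_mul, ← map_mul, ← map_mul, ← map_mul] at h3
      simpa only [mul_assoc] using h3)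
  have h3 : p * u * u * u * w' * v * v * v * q = p * (u * u * u * w' * v * v * v) * q := by
    simp only [mul_assoc]
  rwa [h3, map_mul, map_mul, hex w' hw', ← map_mul, ← map_mul] at h2

theorem imageHom_ne_zero {d e : X.𝕂} {s : Karoubi.Hom d e} (hs : s.val ≠ 0) :
    imageHom f k s ≠ 0 := by
  obtain ⟨w, hw⟩ := exists_cls hs
  obtain ⟨u, hu, hku, h₁⟩ := exists_imageIdem_eq f k (Karoubi.Hom.target_ne_zero hs)
  obtain ⟨v, hv, hkv, h₂⟩ := exists_imageIdem_eq f k (Karoubi.Hom.source_ne_zero hs)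
  rw [R.imageHom_eq hs hw, h₁, h₂, ← map_mul, ← map_mul, ← map_mul, ← map_mul]
  refine R.cls_lift_ne_zero ?_
  simpa only [map_mul, hu, hv, hw, e.isIdem.eq, d.isIdem.eq, s.mem] using hs

theorem imageHom_injective {d e : X.𝕂} {s s' : Karoubi.Hom d e}
    (h : imageHom f k s = imageHom f k s') : s = s' := by
  refine Karoubi.Hom.ext ?_
  by_cases hs : s.val = 0
  · by_contra hne
    exact R.imageHom_ne_zero (s := s') (fun h' => hne (hs.trans h'.symm))
      (h ▸ imageHom_of_eq_zero hs)
  by_cases hs' : s'.val = 0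
  · exact absurd (h.trans (imageHom_of_eq_zero hs')) (R.imageHom_ne_zero hs)
  obtain ⟨w, hw⟩ := exists_cls hs
  obtain ⟨w', hw'⟩ := exists_cls hs'
  obtain ⟨u, hu, hku, h₁⟩ := exists_imageIdem_eq f k (Karoubi.Hom.target_ne_zero hs)
  obtain ⟨v, hv, hkv, h₂⟩ := exists_imageIdem_eq f k (Karoubi.Hom.source_ne_zero hs)
  rw [R.imageHom_eq hs hw, R.imageHom_eq hs' hw', h₁, h₂] at h
  have hiu : IsIdempotentElem (X.cls u) := hu ▸ e.isIdem
  have hiv : IsIdempotentElem (X.cls v) := hv ▸ d.isIdem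
  have hY : Y.cls (FreeSemigroup.lift f (u * u * u * w * v * v * v)) =
      Y.cls (FreeSemigroup.lift f (u * u * u * w' * v * v * v)) := by
    simpa only [map_mul, mul_assoc] using h
  have hm : X.cls u * X.cls w * X.cls v = X.cls w := by rw [hu, hv, hw, s.mem]
  have hm' : X.cls u * X.cls w' * X.cls v = X.cls w' := by rw [hu, hv, hw', s'.mem]
  rw [← hw, ← hw', cls_eq_iff]
  exact fun p q => ⟨R.mem_of_cls_lift_eq hku hkv hiu hiv hm hm' (hw' ▸ hs') hY p q,
    R.mem_of_cls_lift_eq hku hkv hiu hiv hm' hm (hw ▸ hs) hY.symm p q⟩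

theorem imageHom_surjective {d e : X.𝕂} {t : Y.S}
    (ht : imageIdem f k e * t * imageIdem f k d = t) :
    ∃ s : Karoubi.Hom d e, imageHom f k s = t := by
  by_cases ht0 : t = 0
  · exact ⟨⟨0, by simp⟩, (imageHom_of_eq_zero rfl).trans ht0.symm⟩
  by_cases he : e.idem = 0
  · rw [imageIdem_of_eq_zero f k he, zero_mul, zero_mul] at ht
    exact absurd ht.symm ht0
  by_cases hd : d.idem = 0
  · rw [imageIdem_of_eq_zero f k hd, mul_zero] at ht
    exact absurd ht.symm ht0
  obtain ⟨r, rfl⟩ := exists_cls ht0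
  obtain ⟨u, hu, hku, h₁⟩ := exists_imageIdem_eq f k he
  obtain ⟨v, hv, hkv, h₂⟩ := exists_imageIdem_eq f k hd
  have hiu : IsIdempotentElem (X.cls u) := hu ▸ e.isIdem
  have hiv : IsIdempotentElem (X.cls v) := hv ▸ d.isIdem
  obtain ⟨m, hm0, hm⟩ := R.exists_lift_eq (r := r) hku hkv
    (by rwa [map_mul, map_mul, hiu, hiu, hu]) (by rwa [map_mul, map_mul, hiv, hiv, hv])
    (by rwa [map_mul, map_mul, ← h₁, ← h₂, ht])
  refine ⟨⟨X.cls (u * m * v), ?_⟩, ?_⟩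
  · calc _ = (X.cls u * X.cls u) * X.cls m * (X.cls v * X.cls v) := by
          simp only [map_mul, mul_assoc, hu, hv]
      _ = _ := by rw [hiu, hiv, map_mul, map_mul]
  · rw [R.imageHom_eq hm0 rfl]
    -- As f(m) = f(u) r f(v), the image of u m v is f(uu) r f(vv), whose outer factors are absorbed
    -- by the flanking idempotents.
    have e₁ : imageIdem f k e * Y.cls (FreeSemigroup.lift f (u * u)) = imageIdem f k e := by
      rw [h₁, ← map_mul, ← map_mul]
      have := R.cls_lift_mul_mul hku hiu (hu ▸ he) (w := u * u * u) (by simp only [map_mul, hiu.eq])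
      simpa only [mul_assoc] using this
    have e₂ : Y.cls (FreeSemigroup.lift f (v * v)) * imageIdem f k d = imageIdem f k d := by
      rw [h₂, ← map_mul, ← map_mul]
      have := R.cls_lift_mul_mul hkv hiv (hv ▸ hd) (w := v * v * v) (by simp only [map_mul, hiv.eq])
      simpa only [mul_assoc] using this
    calc _ = (imageIdem f k e * Y.cls (FreeSemigroup.lift f (u * u))) * Y.cls r *
          (Y.cls (FreeSemigroup.lift f (v * v)) * imageIdem f k d) := by
          rw [map_mul (FreeSemigroup.lift f), map_mul (FreeSemigroup.lift f), hm]
          simp only [map_mul, mul_assoc]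
      _ = _ := by rw [e₁, e₂, ht]

/-- The functor between Karoubi envelopes induced by a recognizable substitution. -/
noncomputable def functor : X.𝕂 ⥤ Y.𝕂 where
  obj e := ⟨imageIdem f k e, R.isIdempotentElem_imageIdem e⟩
  map s := ⟨imageHom f k s, R.imageIdem_mul_imageHom s⟩
  map_id e := Karoubi.Hom.ext (R.imageHom_id e)
  map_comp t s := Karoubi.Hom.ext (R.imageHom_mul s t _ rfl)

instance : R.functor.PreservesZeroMorphisms where
  map_zero _ _ := Karoubi.Hom.ext (imageHom_of_eq_zero rfl)

instance : R.functor.Faithful where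
  map_injective h := R.imageHom_injective (congrArg Karoubi.Hom.val h)

instance : R.functor.Full where
  map_surjective t := by
    obtain ⟨s, hs⟩ := R.imageHom_surjective (Karoubi.Hom.mem t)
    exact ⟨s, Karoubi.Hom.ext hs⟩

end Recognizable

theorem Karoubi.nonempty_iso {S : Type u} [SemigroupWithZero S] {d e : Karoubi S} {a b : S}
    (ha : e.idem * a * d.idem = a) (hb : d.idem * b * e.idem = b) (hab : a * b = e.idem)
    (hba : b * a = d.idem) : Nonempty (d ≅ e) :=
  ⟨⟨(⟨a, ha⟩ : Karoubi.Hom d e), (⟨b, hb⟩ : Karoubi.Hom e d), Karoubi.Hom.ext hba,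
    Karoubi.Hom.ext hab⟩⟩

theorem map_wordPow {A B : Type u} (h : FreeSemigroup A →ₙ* FreeSemigroup B)
    (u : FreeSemigroup A) (n : ℕ) : h (wordPow u n) = wordPow (h u) n := by
  induction n with
  | zero => rfl
  | succ n ih => rw [wordPow, map_mul, ih]; rfl

/-! ### Essential surjectivity, from periodic words -/

namespace Recognizable

variable {f : X.alphabet → FreeSemigroup Y.alphabet} {k : ℕ} (R : Recognizable X Y f k)

include R

/-- A nonzero idempotent of `S(Y)` is conjugate to the image of a periodic word of `X`. -/
theorem exists_conj_image {g : Y.S} (hg : IsIdempotentElem g) (hg0 : g ≠ 0) :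
    ∃ (v : FreeSemigroup X.alphabet) (a b : Y.S), a * b = g ∧
      b * a = Y.cls (FreeSemigroup.lift f v) ∧ IsIdempotentElem (b * a) ∧ k ≤ v.length ∧
      ∀ n, X.cls (wordPow v n) ≠ 0 := by
  obtain ⟨r, rfl⟩ := exists_cls hg0
  obtain ⟨u, r₁, r₂, hr, hu, hun⟩ := R.periodic r fun n => by
    rwa [← cls_ne_zero_iff, cls_wordPow hg]
  rw [← letters_lift] at hu
  -- An empty `r₁` or `r₂` has no class in the semigroup, but then f(u) = r, and a = b = [r] works
  -- by idempotency.
  obtain ⟨a, b, hab, hba⟩ : ∃ a b, a * b = Y.cls r ∧ b * a = Y.cls (FreeSemigroup.lift f u) := by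
    by_cases h₁ : r₁ = []
    · refine ⟨_, _, hg, hg.trans (congrArg _ (letters_injective ?_))⟩
      rw [hr, hu, h₁, List.append_nil, List.nil_append]
    by_cases h₂ : r₂ = []
    · refine ⟨_, _, hg, hg.trans (congrArg _ (letters_injective ?_))⟩
      rw [hr, hu, h₂, List.append_nil, List.nil_append]
    obtain ⟨r₁, rfl⟩ := exists_letters h₁
    obtain ⟨r₂, rfl⟩ := exists_letters h₂
    rw [← letters_mul] at hr hu
    exact ⟨Y.cls r₁, Y.cls r₂, by rw [← map_mul, letters_injective hr],
      by rw [← map_mul, letters_injective hu]⟩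
  -- Idempotency of ab does not pass to ba, but it makes the powers of ba stabilize from the second
  -- on.
  have h₃ : b * a * (b * a) * (b * a) = b * a * (b * a) := by
    calc _ = b * ((a * b) * (a * b)) * a := by simp only [mul_assoc]
      _ = b * (a * b) * a := by rw [hab, hg]
      _ = _ := by simp only [mul_assoc]
  have hpow : ∀ n, Y.cls (FreeSemigroup.lift f (wordPow u (n + 1))) = b * a * (b * a) := by
    intro n
    induction n with
    | zero => rw [wordPow, map_mul, map_mul, wordPow, hba]
    | succ n ih => rw [wordPow, map_mul, map_mul, ih, ← hba, h₃]
  -- Replacing b by bab preserves the product g on one side and gives the idempotent (ba)² on the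
  -- other. It is the class of f(uⁿ) for every n ≥ 2; the exponent k + 2 taken here also ensures
  -- length at least k.
  refine ⟨wordPow u (k + 1), a, b * a * b, ?_, ?_, ?_, ?_, fun n => ?_⟩
  · rw [← hg, ← hab]; simp only [mul_assoc]
  · rw [hpow]; simp only [mul_assoc]
  · calc _ = b * a * (b * a) * (b * a) * (b * a) := by simp only [mul_assoc]
      _ = b * a * (b * a) := by rw [h₃, h₃]
      _ = _ := by simp only [mul_assoc]
  · have := le_length_wordPow u (k + 1)
    omega
  · rw [wordPow_wordPow, cls_ne_zero_iff]
    exact hun _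

/-- All powers of f(v) have the same contexts. With enough copies of `v` for the overlap, gluing
transfers this to X and shows that v⁵ and v⁶ have the same contexts; then v⁵ absorbs any number of
further copies. -/
theorem isIdempotentElem_cls_pow {v : FreeSemigroup X.alphabet} (hk : k ≤ v.length)
    (hv : IsIdempotentElem (Y.cls (FreeSemigroup.lift f v))) :
    IsIdempotentElem (X.cls (v * v * v * v * v)) := by
  have hl : ∀ a b : FreeSemigroup X.alphabet, X.cls (a * b) ≠ 0 → X.cls a ≠ 0 := by
    intro a b h h'
    rw [map_mul, h', zero_mul] at h
    exact h rfl
  have hr : ∀ a b : FreeSemigroup X.alphabet, X.cls (a * b) ≠ 0 → X.cls b ≠ 0 := by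
    intro a b h h'
    rw [map_mul, h', mul_zero] at h
    exact h rfl
  have hc := hv.eq
  have hc' : ∀ t, Y.cls (FreeSemigroup.lift f v) * (Y.cls (FreeSemigroup.lift f v) * t) =
      Y.cls (FreeSemigroup.lift f v) * t := fun t => by rw [← mul_assoc, hc]
  have key : X.cls (v * v * v * v * v) = X.cls (v * v * v * v * v * v) := by
    refine cls_eq_iff.2 fun p q => ⟨mem_of_margins (k := k) (fun p' p q q' hp hq h => ?_) p q,
      mem_of_margins (k := k) (fun p' p q q' hp hq h => ?_) p q⟩
    · have h' := R.ne_zero_of_locked (R.locked_glue (p := p') (z₁ := p * v) (v := v)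
        (z₂ := v * v * q) (q := q') hp hk hq
        (hl _ (v * q * q') (by simpa only [mul_assoc] using h))
        (hr (p' * p) _ (by simpa only [mul_assoc] using h))) (by
          have := R.cls_lift_ne_zero h
          simp only [map_mul, mul_assoc, hc'] at this ⊢
          exact this)
      simpa only [mul_assoc] using h'
    · have h' := R.ne_zero_of_locked (R.locked_glue (p := p') (z₁ := p * v) (v := v)
        (z₂ := v * q) (q := q') hp hk hq
        (hl _ (v * v * q * q') (by simpa only [mul_assoc] using h))
        (hr (p' * p * v * v) _ (by simpa only [mul_assoc] using h))) (by
          have := R.cls_lift_ne_zero h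
          simp only [map_mul, mul_assoc, hc'] at this ⊢
          exact this)
      simpa only [mul_assoc] using h'
  have h1 : X.cls (v * v * v * v * v) * X.cls v = X.cls (v * v * v * v * v) := by
    rw [← map_mul, ← key]
  calc _ = X.cls (v * v * v * v * v) * X.cls v * X.cls v * X.cls v * X.cls v * X.cls v := by
        simp only [map_mul, mul_assoc]
    _ = _ := by simp only [h1]

/-- The idempotent g = ab is conjugate to ba = [f(V)]. The image E of [V] is built from a chosen
word `u` in the class of V, possibly another one; still (ba)E(ba) = ba and E(ba)E = E, by exchanging
V and u between margins. Hence E is isomorphic to ba, and so to g. -/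
instance : R.functor.EssSurj where
  mem_essImage g := by
    by_cases hg : g.idem = 0
    · refine ⟨⟨0, mul_zero 0⟩, Karoubi.nonempty_iso (a := 0) (b := 0) (by simp) (by simp) ?_ ?_⟩
      · rw [hg, mul_zero]
      · exact (mul_zero _).trans (imageIdem_of_eq_zero f k rfl).symm
    obtain ⟨v, a, b, hab, hba, hi, hk, hpow⟩ := R.exists_conj_image g.isIdem hg
    have hc : IsIdempotentElem (Y.cls (FreeSemigroup.lift f v)) := hba ▸ hi
    obtain ⟨V, hVi, hV0, hkV, hV⟩ : ∃ V, IsIdempotentElem (X.cls V) ∧ X.cls V ≠ 0 ∧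
        k ≤ V.length ∧ Y.cls (FreeSemigroup.lift f V) = b * a :=
      ⟨v * v * v * v * v, R.isIdempotentElem_cls_pow hk hc, hpow 4,
        by simp only [FreeSemigroup.length_mul]; omega, by simp only [map_mul, hc.eq, hba]⟩
    obtain ⟨u, hu, hku, hE⟩ := exists_imageIdem_eq f k (e := ⟨X.cls V, hVi⟩) hV0
    replace hu : X.cls u = X.cls V := hu
    have hui : IsIdempotentElem (X.cls u) := hu ▸ hVi
    have hEi := R.isIdempotentElem_imageIdem ⟨X.cls V, hVi⟩
    have h₁ : b * a * imageIdem f k ⟨X.cls V, hVi⟩ * (b * a) = b * a := by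
      have := R.cls_lift_mul_mul hkV hVi hV0 (w := u * u * u) (by simp only [map_mul, hu, hVi.eq])
      rwa [map_mul, map_mul, map_mul, map_mul, ← hE, map_mul, map_mul, map_mul, map_mul, hV, hi,
        hi] at this
    have h₂ : imageIdem f k ⟨X.cls V, hVi⟩ * (b * a) * imageIdem f k ⟨X.cls V, hVi⟩ =
        imageIdem f k ⟨X.cls V, hVi⟩ := by
      have := R.cls_lift_mul_mul hku hui (hu ▸ hV0) (w := u * u * V * u * u)
        (by simp only [map_mul, ← hu, hui.eq])
      rw [← hE] at this
      conv_rhs => rw [← this]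
      rw [← hV, hE]
      simp only [map_mul, mul_assoc]
    refine ⟨⟨X.cls V, hVi⟩, Karoubi.nonempty_iso (a := a * b * a * imageIdem f k ⟨X.cls V, hVi⟩)
      (b := imageIdem f k ⟨X.cls V, hVi⟩ * b * (a * b)) ?_ ?_ ?_ ?_⟩
    · change g.idem * _ * imageIdem f k ⟨X.cls V, hVi⟩ = _
      rw [mul_assoc, mul_assoc _ _ (imageIdem f k ⟨X.cls V, hVi⟩), hEi, mul_assoc (a * b),
        ← mul_assoc, hab, g.isIdem]
    · change imageIdem f k ⟨X.cls V, hVi⟩ * _ * g.idem = _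
      rw [mul_assoc, mul_assoc, mul_assoc _ b, ← mul_assoc (imageIdem f k _), hEi, hab, g.isIdem,
        mul_assoc]
    · calc _ = a * (b * a * (imageIdem f k ⟨X.cls V, hVi⟩ * imageIdem f k ⟨X.cls V, hVi⟩) *
            (b * a)) * b := by simp only [mul_assoc]
        _ = a * b * (a * b) := by rw [hEi, h₁]; simp only [mul_assoc]
        _ = _ := by rw [hab, g.isIdem]
    · calc _ = imageIdem f k ⟨X.cls V, hVi⟩ * (b * ((a * b) * (a * b)) * a) *
            imageIdem f k ⟨X.cls V, hVi⟩ := by simp only [mul_assoc]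
        _ = imageIdem f k ⟨X.cls V, hVi⟩ * (b * a * (b * a)) * imageIdem f k ⟨X.cls V, hVi⟩ := by
          rw [hab, g.isIdem, ← hab]; simp only [mul_assoc]
        _ = _ := by rw [hi, h₂]; rfl

end Recognizable

/-! ### Images of left-infinite sequences -/

section Sequences

variable {A B : Type u}

theorem lastLetters_eq_of_suffix {x : ℕ → A} {m n : ℕ} {l : List A} (h : l <:+ lastLetters x n)
    (hl : l.length = m) : lastLetters x m = l := by
  subst hl
  have hle : l.length ≤ n := by simpa using h.length_le
  obtain ⟨l', hl'⟩ := exists_lastLetters_eq_append x hle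
  have h' : lastLetters x l.length <:+ lastLetters x n := ⟨l', hl'.symm⟩
  exact (List.suffix_of_suffix_length_le h' h (by simp)).eq_of_length (by simp)

theorem eq_of_lastLetters_eq_of_le {x x' : ℕ → A}
    (h : ∀ n, ∃ m, n ≤ m ∧ lastLetters x m = lastLetters x' m) : x = x' := by
  refine eq_of_lastLetters_eq fun n => ?_
  obtain ⟨m, hm, e⟩ := h n
  obtain ⟨l, hl⟩ := exists_lastLetters_eq_append x' hm
  exact lastLetters_eq_of_suffix (n := m) (e ▸ ⟨l, hl.symm⟩) (by simp)

/-- A chain of suffixes of unbounded length has a limit. Reading the letter at depth n + 1 in the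
word of index n + 1 is harmless, since comparable words agree counted from the right. -/
theorem exists_lastLetters_eq {ℓ : ℕ → List A} (h : ∀ n, ℓ n <:+ ℓ (n + 1))
    (hl : ∀ n, n ≤ (ℓ n).length) : ∃ x : ℕ → A, ∀ n, lastLetters x (ℓ n).length = ℓ n := by
  have hmono : ∀ {m n}, m ≤ n → ℓ m <:+ ℓ n := by
    intro m n hmn
    induction n, hmn using Nat.le_induction with
    | base => exact List.suffix_rfl
    | succ n _ ih => exact ih.trans (h n)
  have hlt : ∀ n, (ℓ (n + 1)).length - (n + 1) < (ℓ (n + 1)).length := fun n => by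
    have := hl (n + 1); omega
  refine ⟨fun n => (ℓ (n + 1))[(ℓ (n + 1)).length - (n + 1)]'(hlt n), ?_⟩
  have key : ∀ m n, m ≤ (ℓ n).length → lastLetters (fun n =>
      (ℓ (n + 1))[(ℓ (n + 1)).length - (n + 1)]'(hlt n)) m = (ℓ n).drop ((ℓ n).length - m) := by
    intro m
    induction m with
    | zero => intro n _; simp [lastLetters]
    | succ m ih =>
      intro n hm
      rw [lastLetters, ih n (by omega), List.drop_eq_getElem_cons (i := (ℓ n).length - (m + 1))
        (by omega), show (ℓ n).length - (m + 1) + 1 = (ℓ n).length - m by omega]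
      congr 1
      have key2 : ∀ {a b : List A}, a <:+ b → ∀ (j : ℕ) (h1 : a.length - (j + 1) < a.length)
          (h2 : b.length - (j + 1) < b.length), j < a.length →
          a[a.length - (j + 1)] = b[b.length - (j + 1)] := by
        rintro a b ⟨c, rfl⟩ j h1 h2 hj
        simp only [List.length_append]
        rw [List.getElem_append_right (by omega)]
        congr 1
        omega
      have h1 := hl (m + 1)
      rcases le_total n (m + 1) with hc | hc
      · exact (key2 (hmono hc) m (by omega) (by omega) (by omega)).symm
      · exact key2 (hmono hc) m (by omega) (by omega) (by omega)
  intro n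
  rw [key _ n le_rfl]
  simp

theorem exists_substLeft (f : A → FreeSemigroup B) (x : ℕ → A) : ∃ z : ℕ → B, ∀ n,
    lastLetters z (substWord f (lastLetters x n)).length = substWord f (lastLetters x n) :=
  exists_lastLetters_eq (fun n => ⟨letters (f (x n)), rfl⟩) fun n => by
    simpa using length_le_length_substWord f (lastLetters x n)

/-- The image of a left-infinite sequence under a substitution. -/
noncomputable def substLeft (f : A → FreeSemigroup B) (x : ℕ → A) : ℕ → B :=
  (exists_substLeft f x).choose

theorem lastLetters_substLeft (f : A → FreeSemigroup B) (x : ℕ → A) (n : ℕ) :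
    lastLetters (substLeft f x) (substWord f (lastLetters x n)).length =
      substWord f (lastLetters x n) := (exists_substLeft f x).choose_spec n

theorem substLeft_appendWord (f : A → FreeSemigroup B) (x : ℕ → A) (w : List A) :
    substLeft f (appendWord x w) = appendWord (substLeft f x) (substWord f w) := by
  refine eq_of_lastLetters_eq_of_le fun n =>
    ⟨(substWord f (lastLetters x n)).length + (substWord f w).length, ?_, ?_⟩
  · have := length_le_length_substWord f (lastLetters x n)
    rw [length_lastLetters] at this
    omega
  · rw [lastLetters_appendWord, lastLetters_substLeft]
    have := lastLetters_substLeft f (appendWord x w) (n + w.length)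
    rwa [lastLetters_appendWord, substWord_append, List.length_append] at this

end Sequences

/-- Suffixes of f(x) starting at a boundary between images of letters are arbitrarily long, so they
suffice. -/
theorem follows_substLeft_iff {f : X.alphabet → FreeSemigroup Y.alphabet} {x : ℕ → X.alphabet}
    {r : List Y.alphabet} (hr : r ≠ []) : Follows (X := Y) (substLeft f x) r ↔
      ∀ n, substWord f (lastLetters x n) ++ r ∈ Y.language := by
  constructor
  · intro h n
    rw [← lastLetters_substLeft]
    exact h _
  · intro h
    refine follows_of_le hr fun n => ⟨(substWord f (lastLetters x n)).length, ?_, ?_⟩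
    · simpa using length_le_length_substWord f (lastLetters x n)
    · rw [lastLetters_substLeft]
      exact h n

theorem follows_congr {x : ℕ → X.alphabet} {a b : FreeSemigroup X.alphabet}
    (h : X.cls a = X.cls b) (w : List X.alphabet) :
    Follows x (letters a ++ w) ↔ Follows x (letters b ++ w) :=
  forall_congr' fun n => by
    rw [← List.append_assoc, ← List.append_assoc]
    exact cls_eq_iff.1 h _ _

theorem act_act_cls (q : X.Q) (a b : FreeSemigroup X.alphabet) :
    X.kriegerAction.act (X.kriegerAction.act q (X.cls a)) (X.cls b) =
      X.kriegerAction.act q (X.cls (a * b)) := by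
  rw [map_mul, X.kriegerAction.act_mul]

theorem act_vertex_eq_iff {x x' : ℕ → X.alphabet} {u : FreeSemigroup X.alphabet} :
    X.kriegerAction.act (X.vertex x) (X.cls u) = X.kriegerAction.act (X.vertex x') (X.cls u) ↔
      ∀ w : FreeSemigroup X.alphabet,
        Follows x (letters u ++ letters w) ↔ Follows x' (letters u ++ letters w) := by
  rw [act_vertex_cls, act_vertex_cls, vertex_eq_iff]
  refine forall_congr' fun w => ?_
  rw [follows_appendWord (letters_ne_nil w), follows_appendWord (letters_ne_nil w)]

/-- A left margin inside `x` itself, with one letter more than `k` so that it is nonempty when k =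
0. -/
theorem exists_lastLetters_margin {x : ℕ → X.alphabet} (k n : ℕ) :
    ∃ l : FreeSemigroup X.alphabet, k ≤ l.length ∧
      letters l ++ lastLetters x n = lastLetters x (k + 1 + n) := by
  obtain ⟨l, hl⟩ := exists_lastLetters_eq_append x (show n ≤ k + 1 + n by omega)
  have := congrArg List.length hl
  simp only [length_lastLetters, List.length_append] at this
  obtain ⟨l, rfl⟩ := exists_letters (l := l) (List.ne_nil_of_length_pos (by omega))
  rw [length_letters] at this
  exact ⟨l, by omega, hl.symm⟩

/-! ### Desubstitution after left-infinite sequences -/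

namespace Recognizable

variable {f : X.alphabet → FreeSemigroup Y.alphabet} {k : ℕ} (R : Recognizable X Y f k)

include R

/-- Each suffix of `x` gives its own desubstituted continuation. Cut to bounded length, these take
finitely many values, so one of them works for arbitrarily long suffixes, hence for all. -/
theorem exists_follows_desubst {x : ℕ → X.alphabet} {u : FreeSemigroup X.alphabet}
    (hku : k ≤ u.length) (hu : IsIdempotentElem (X.cls u)) (hx : Follows x (letters u))
    {r : List Y.alphabet} (hr : r ≠ [])
    (h : Follows (X := Y) (substLeft f x) (substWord f (letters (u * u * u)) ++ r)) :
    ∃ z, z ≠ [] ∧ Follows x (letters (u * u) ++ z) ∧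
      ∃ t, substWord f z = substWord f (letters u) ++ r ++ t := by
  set N := (substWord f (letters u) ++ r).length with hN
  have key : ∀ n, ∃ z : List X.alphabet, z.length ≤ N ∧
      lastLetters x n ++ letters (u * u) ++ z ∈ X.language ∧
      ∃ t, substWord f z = substWord f (letters u) ++ r ++ t := by
    intro n
    obtain ⟨l, hl, hln⟩ := exists_lastLetters_margin (x := x) k n
    have h1 := (follows_substLeft_iff (by simp [hr])).1 h (k + 1 + n)
    obtain ⟨v, hv, s, t, e⟩ := R.exists_factor _ h1
    have h2 : Follows x (letters (u * u * u)) := by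
      have := (follows_congr (x := x) (a := u * u * u) (b := u) (by simp only [map_mul, hu.eq]) [])
      simp only [List.append_nil] at this
      exact this.2 hx
    have h3 := h2 (k + 1 + n)
    rw [← hln] at h3 e
    obtain ⟨v₁, v₂, rfl, e₁, e₂⟩ := R.locked (p := letters l)
      (z := lastLetters x n ++ letters (u * u)) (q := letters u) (by simp [letters_ne_nil])
      hl hku (by simpa [letters_mul] using h3) v hv s (r ++ t) (by
        rw [e]; simp [letters_mul])
    -- Images are at least as long as words, so N letters suffice to cover f(u) r, which has length
    -- N.
    refine ⟨v₂.take N, by simp, ?_, ?_⟩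
    · refine mem_language_of_append (p := v₁) (q := v₂.drop N) ?_ (by simp [letters_ne_nil])
      simpa using hv
    · have h4 : substWord f (letters u) ++ r <+: substWord f v₂ := ⟨t, by rw [e₂]; simp⟩
      have h5 : substWord f (v₂.take N) <+: substWord f v₂ :=
        ⟨substWord f (v₂.drop N), by rw [← substWord_append, List.take_append_drop]⟩
      obtain ⟨t', ht'⟩ := List.prefix_of_prefix_length_le h4 h5 (by
        rcases le_total N v₂.length with hc | hc
        · refine le_trans ?_ (length_le_length_substWord f _)
          rw [List.length_take, min_eq_left hc]
        · rw [List.take_of_length_le hc]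
          exact h4.length_le)
      exact ⟨t', ht'.symm⟩
  choose z hzN hz hzt using key
  have : Finite {l : List X.alphabet // l.length ≤ N} := (List.finite_length_le _ N).to_subtype
  obtain ⟨⟨z₀, hz₀⟩, hinf⟩ := Finite.exists_infinite_fiber
    (fun n => (⟨z n, hzN n⟩ : {l : List X.alphabet // l.length ≤ N}))
  have hinf' := Set.infinite_coe_iff.1 hinf
  have hfr : ∀ n, ∃ m, n ≤ m ∧ z m = z₀ := by
    intro n
    obtain ⟨m, hm, hm'⟩ := hinf'.exists_gt n
    exact ⟨m, hm'.le, congrArg Subtype.val hm⟩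
  obtain ⟨m₀, -, hm₀⟩ := hfr 0
  refine ⟨z₀, ?_, follows_of_le (by simp [letters_ne_nil]) fun n => ?_, hm₀ ▸ hzt m₀⟩
  · rintro rfl
    obtain ⟨t, ht⟩ := hzt m₀
    simp [hm₀, hr] at ht
  · obtain ⟨m, hm, rfl⟩ := hfr n
    exact ⟨m, hm, by simpa using hz m⟩

omit R in
theorem follows_cube {x : ℕ → X.alphabet} {u : FreeSemigroup X.alphabet}
    (hu : IsIdempotentElem (X.cls u)) (w : List X.alphabet) :
    Follows x (letters (u * u * u) ++ w) ↔ Follows x (letters u ++ w) :=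
  follows_congr (by simp only [map_mul, hu.eq]) w

theorem follows_substLeft {x : ℕ → X.alphabet} {w : List X.alphabet} (hw : w ≠ [])
    (h : Follows x w) : Follows (X := Y) (substLeft f x) (substWord f w) :=
  (follows_substLeft_iff fun h => hw ((substWord_eq_nil_iff f).1 h)).2 fun n => by
    rw [← substWord_append]
    exact R.mem _ (h n)

/-- Makes the image of a vertex independent of the sequence representing it. A word r readable after
f(x)f(u³) is covered by the image of some z with u u z readable after `x`; then u u z is readable
after `x'`, and applying `f` shows that r is readable after f(x')f(u³). -/
theorem act_substLeft_eq {x x' : ℕ → X.alphabet} {u : FreeSemigroup X.alphabet}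
    (hku : k ≤ u.length) (hu : IsIdempotentElem (X.cls u)) (hx : Follows x (letters u))
    (hx' : Follows x' (letters u))
    (h : X.kriegerAction.act (X.vertex x) (X.cls u) = X.kriegerAction.act (X.vertex x') (X.cls u)) :
    Y.kriegerAction.act (Y.vertex (substLeft f x)) (Y.cls (FreeSemigroup.lift f (u * u * u))) =
      Y.kriegerAction.act (Y.vertex (substLeft f x'))
        (Y.cls (FreeSemigroup.lift f (u * u * u))) := by
  have key : ∀ {x x' : ℕ → X.alphabet}, Follows x (letters u) →
      (∀ w : FreeSemigroup X.alphabet,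
        Follows x (letters u ++ letters w) ↔ Follows x' (letters u ++ letters w)) →
      ∀ r : FreeSemigroup Y.alphabet,
        Follows (X := Y) (substLeft f x) (substWord f (letters (u * u * u)) ++ letters r) →
        Follows (X := Y) (substLeft f x') (substWord f (letters (u * u * u)) ++ letters r) := by
    intro x x' hx h r hr
    obtain ⟨z, hz, hxz, t, ht⟩ := R.exists_follows_desubst hku hu hx (letters_ne_nil r) hr
    obtain ⟨z, rfl⟩ := exists_letters hz
    have h1 := (h (u * z)).1 (by simpa [letters_mul] using hxz)
    have h2 := R.follows_substLeft (by simp [letters_ne_nil]) h1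
    refine Follows.of_append (r := t) ?_ (by simp [letters_ne_nil])
    simpa [letters_mul, ht] using h2
  rw [act_vertex_eq_iff] at h ⊢
  intro r
  rw [letters_lift]
  exact ⟨key hx h r, key hx' (fun w => (h w).symm) r⟩

/-- Injectivity on vertices. A continuation w of `x` is prolonged by a right margin r and
transported through `f` to f(x'). To return to `x'`, a suffix of `x'` followed by u³ is glued to
u⁵wr, the latter being a word of X because it is readable after `x`. -/
theorem act_eq_of_act_substLeft_eq {x x' : ℕ → X.alphabet} {u : FreeSemigroup X.alphabet}
    (hku : k ≤ u.length) (hu : IsIdempotentElem (X.cls u)) (hx : Follows x (letters u))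
    (hx' : Follows x' (letters u))
    (h : Y.kriegerAction.act (Y.vertex (substLeft f x))
        (Y.cls (FreeSemigroup.lift f (u * u * u))) =
      Y.kriegerAction.act (Y.vertex (substLeft f x'))
        (Y.cls (FreeSemigroup.lift f (u * u * u)))) :
    X.kriegerAction.act (X.vertex x) (X.cls u) = X.kriegerAction.act (X.vertex x') (X.cls u) := by
  have key : ∀ {x x' : ℕ → X.alphabet}, Follows x' (letters u) →
      (∀ r : FreeSemigroup Y.alphabet,
        Follows (X := Y) (substLeft f x) (substWord f (letters (u * u * u)) ++ letters r) →
        Follows (X := Y) (substLeft f x') (substWord f (letters (u * u * u)) ++ letters r)) →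
      ∀ w : FreeSemigroup X.alphabet,
        Follows x (letters u ++ letters w) → Follows x' (letters u ++ letters w) := by
    intro x x' hx' h w hw
    have h5 : X.cls (u * u * u * u * u) = X.cls u := by simp only [map_mul, hu.eq]
    obtain ⟨r, hrk, hr⟩ := ((follows_congr h5 (letters w)).2 hw).exists_append
      (by simp [letters_ne_nil]) (k + 1)
    obtain ⟨r, rfl⟩ := exists_letters (l := r) (List.ne_nil_of_length_pos (by omega))
    rw [length_letters] at hrk
    have h1 := R.follows_substLeft (by simp [letters_ne_nil]) hr
    have h2 := h (FreeSemigroup.lift f (u * u * w * r)) (by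
      rw [letters_lift]
      simpa [letters_mul] using h1)
    rw [letters_lift, follows_substLeft_iff (by
      rw [← substWord_append, Ne, substWord_eq_nil_iff]; simp [letters_ne_nil])] at h2
    rw [← follows_congr h5]
    refine follows_of_le (by simp [letters_ne_nil]) fun n => ⟨n + 1, by omega, ?_⟩
    obtain ⟨l, hl, hln⟩ := exists_lastLetters_margin (x := x') k (n + 1)
    have h3 := h2 (k + 1 + (n + 1))
    have h4 := (follows_cube hu []).2 (by simpa using hx') (k + 1 + (n + 1))
    rw [← hln] at h3 h4
    obtain ⟨p, hp⟩ := exists_letters (l := lastLetters x' (n + 1)) (by simp [lastLetters])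
    rw [← hp] at h3 h4 ⊢
    have h6 := R.ne_zero_of_locked (R.locked_glue (p := l) (z₁ := p) (v := u) (z₂ := u * u * w)
      (q := r) hl hku (by omega) (by
        rw [cls_ne_zero_iff]; simpa [letters_mul] using h4) (by
        rw [cls_ne_zero_iff]
        refine mem_language_of_append (p := []) (q := []) ?_ (letters_ne_nil _)
        simpa [letters_mul, lastLetters] using hr 0)) (by
        rw [cls_ne_zero_iff, letters_lift]; simpa [letters_mul] using h3)
    rw [cls_ne_zero_iff] at h6
    simpa [letters_mul] using h6
  rw [act_vertex_eq_iff] at h ⊢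
  simp only [letters_lift] at h
  exact fun w => ⟨key hx' (fun r => (h r).1) w, key hx (fun r => (h r).2) w⟩

/-- Serves naturality when q·s = ∅. A suffix of `x` followed by u³ is glued to u³wv³ along u³, the
last v being spent as right margin. -/
theorem follows_of_substLeft {x : ℕ → X.alphabet} {u w v : FreeSemigroup X.alphabet}
    (hku : k ≤ u.length) (hkv : k ≤ v.length) (hx : Follows x (letters (u * u * u)))
    (hw : X.cls (u * u * u * w * v * v * v) ≠ 0)
    (h : Follows (X := Y) (substLeft f x)
      (substWord f (letters (u * u * u * w * v * v * v)))) :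
    Follows x (letters (u * u * u * w * v)) := by
  rw [follows_substLeft_iff (by rw [Ne, substWord_eq_nil_iff]; simp [letters_ne_nil])] at h
  refine follows_of_le (letters_ne_nil _) fun n => ⟨n + 1, by omega, ?_⟩
  obtain ⟨l, hl, hln⟩ := exists_lastLetters_margin (x := x) k (n + 1)
  have h3 := h (k + 1 + (n + 1))
  have h4 := hx (k + 1 + (n + 1))
  rw [← hln] at h3 h4
  obtain ⟨p, hp⟩ := exists_letters (l := lastLetters x (n + 1)) (by simp [lastLetters])
  rw [← hp] at h3 h4 ⊢
  have h6 := R.ne_zero_of_locked (R.locked_glue (p := l) (z₁ := p) (v := u) (z₂ := w * v * v)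
      (q := v) hl hku hkv (by
        rw [cls_ne_zero_iff]; simpa [letters_mul] using h4)
        (by simpa only [mul_assoc] using hw)) (by
        rw [cls_ne_zero_iff, letters_lift]; simpa [letters_mul] using h3)
  rw [cls_ne_zero_iff] at h6
  refine mem_language_of_append (p := []) (q := letters v) ?_ (by simp [letters_ne_nil])
  simpa [letters_mul] using h6

/-- Surjectivity on vertices. Locking the middle u desubstitutes (last n letters of b)f(u) into a
suffix of the image of a word of X; a cluster point of these words, written to the left of the
origin, gives x. -/
theorem exists_substLeft_eq_appendWord {b : ℕ → Y.alphabet} {u : FreeSemigroup X.alphabet}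
    (hku : k ≤ u.length) (hu0 : X.cls (u * u * u) ≠ 0)
    (h : Follows (X := Y) b (substWord f (letters (u * u * u)))) :
    ∃ x : ℕ → X.alphabet, Follows x (letters u) ∧
      substLeft f x = appendWord b (substWord f (letters u)) := by
  have key : ∀ n, ∃ v s, v ++ letters u ∈ X.language ∧
      substWord f v = s ++ (lastLetters b n ++ substWord f (letters u)) := by
    intro n
    obtain ⟨v, hv, s, t, e⟩ := R.exists_factor _ (h n)
    rw [cls_ne_zero_iff] at hu0
    obtain ⟨v₁, v₂, rfl, e₁, -⟩ := R.locked (p := letters u) (q := letters u) (letters_ne_nil u)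
      hku hku (by simpa [letters_mul] using hu0) v hv (s ++ lastLetters b n) t
      (by rw [e]; simp [letters_mul])
    refine ⟨v₁, s, mem_language_of_append (p := []) (q := v₂) (by simpa using hv)
      (by simp [letters_ne_nil]), by rw [e₁]; simp⟩
  choose v s hv hvs using key
  choose p hp hpb using fun n : ℕ => exists_block_eq (hv n) (-((v n).length : ℤ))
  obtain ⟨q, hq, hqp⟩ := exists_cluster_point p hp
  have hpb' : ∀ n, block (p n) (-((v n).length : ℤ)) (v n).length = v n ∧
      block (p n) 0 (letters u).length = letters u := by
    intro n
    have := hpb n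
    rw [List.length_append, block_append, neg_add_cancel] at this
    exact List.append_inj this (by simp)
  set x : ℕ → X.alphabet := fun n => q (Int.negSucc n) with hx
  set y : ℕ → X.alphabet := fun n => q (Int.ofNat n) with hy
  have hxy : joinSeq x y = q := joinSeq_eq q
  refine ⟨x, ?_, ?_⟩
  · have h1 : (List.range (letters u).length).map y = letters u := by
      obtain ⟨n, hn, e⟩ := hqp (letters u).length
      conv_rhs => rw [← (hpb' n).2]
      refine List.map_congr_left fun i hi => ?_
      have := List.mem_range.1 hi
      rw [hy, zero_add]
      exact e i (by omega) (by omega)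
    obtain ⟨z, hz⟩ := exists_prependWord h1
    refine follows_of_joinSeq (y := z) (letters_ne_nil u) ?_
    rwa [← hz, hxy]
  · refine eq_of_lastLetters_eq_of_le fun n => ⟨n + (substWord f (letters u)).length, by omega, ?_⟩
    rw [lastLetters_appendWord]
    set j := n + (substWord f (letters u)).length with hj
    have hsuf : lastLetters b n ++ substWord f (letters u) <:+ substWord f (lastLetters x j) := by
      obtain ⟨m, hm, e⟩ := hqp j
      have h1 : lastLetters x j = block (p m) (-j) j := by
        rw [← lastLetters_eq_block x y, hxy, block_eq_iff]
        exact fun i hi => e _ (by omega) (by omega)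
      obtain ⟨l, hl⟩ := exists_lastLetters_eq_append b (show n ≤ m by omega)
      have h2 : lastLetters b n ++ substWord f (letters u) <:+ substWord f (v m) :=
        ⟨s m ++ l, by rw [hvs, hl]; simp⟩
      have hblk : ∀ c d : ℕ, c ≤ d →
          substWord f (block (p m) (-c) c) <:+ substWord f (block (p m) (-d) d) := by
        intro c d hcd
        obtain ⟨i, rfl⟩ := Nat.exists_eq_add_of_le' hcd
        refine ⟨substWord f (block (p m) (-(i + c : ℕ)) i), ?_⟩
        rw [block_append, substWord_append]
        congr 3
        push_cast; ring
      -- Which of `j` and the length of `v m` is larger is unknown. Both images are suffixes of the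
      -- image of the longer block, so the comparison of lengths decides.
      have h3 := hblk _ _ (le_max_left j (v m).length)
      have h4 := hblk _ _ (le_max_right j (v m).length)
      rw [(hpb' m).1] at h4
      rw [h1]
      refine List.suffix_of_suffix_length_le (h2.trans h4) h3 ?_
      refine le_trans ?_ (length_le_length_substWord f _)
      simp [hj]
    rw [← lastLetters_substLeft] at hsuf
    exact lastLetters_eq_of_suffix hsuf (by simp [hj])

end Recognizable

open Classical in
/-- The image of a vertex of the Krieger cover of `X` that is fixed by the idempotent `e`. -/
noncomputable def imageVertex (f : X.alphabet → FreeSemigroup Y.alphabet) (k : ℕ) (e : X.𝕂)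
    (q : X.Q) : Y.Q :=
  if hq : q = X.Q.point then Y.Q.point else
    Y.kriegerAction.act (Y.vertex (substLeft f (exists_vertex hq).choose)) (imageIdem f k e)

theorem act_idem_of_mem {e : X.𝕂} {q : X.Q} (hq : q ∈ X.𝔸.obj e) :
    X.kriegerAction.act q e.idem = q := by
  obtain ⟨q, rfl⟩ := hq
  change X.kriegerAction.act (X.kriegerAction.act q e.idem) e.idem = X.kriegerAction.act q e.idem
  rw [← X.kriegerAction.act_mul, e.isIdem]

theorem idem_ne_zero_of_act_ne_point {e : X.𝕂} {q : X.Q}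
    (hq : X.kriegerAction.act q e.idem ≠ X.Q.point) : e.idem ≠ 0 := fun h => hq (by
  rw [h, X.kriegerAction.act_zero])

theorem imageVertex_point (f : X.alphabet → FreeSemigroup Y.alphabet) (k : ℕ) (e : X.𝕂) :
    imageVertex f k e X.Q.point = Y.Q.point := dif_pos rfl

theorem imageVertex_mem (f : X.alphabet → FreeSemigroup Y.alphabet) (k : ℕ) (e : X.𝕂) (q : X.Q) :
    imageVertex f k e q ∈ Set.range fun q => Y.kriegerAction.act q (imageIdem f k e) := by
  by_cases hq : q = X.Q.point
  · rw [hq, imageVertex_point]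
    exact ⟨Y.Q.point, Y.kriegerAction.point_act _⟩
  · rw [imageVertex, dif_neg hq]
    exact ⟨_, rfl⟩

/-! ### The natural isomorphism of actions -/

namespace Recognizable

variable {f : X.alphabet → FreeSemigroup Y.alphabet} {k : ℕ} (R : Recognizable X Y f k)

include R

/-- The definition uses some chosen representative of the vertex; `act_substLeft_eq` exchanges it
for `x`. -/
theorem imageVertex_act {e : X.𝕂} {x : ℕ → X.alphabet}
    (hx : X.kriegerAction.act (X.vertex x) e.idem ≠ X.Q.point) :
    imageVertex f k e (X.kriegerAction.act (X.vertex x) e.idem) =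
      Y.kriegerAction.act (Y.vertex (substLeft f x)) (imageIdem f k e) := by
  obtain ⟨u, hu, hku, hE⟩ := exists_imageIdem_eq f k (idem_ne_zero_of_act_ne_point hx)
  have hui : IsIdempotentElem (X.cls u) := hu ▸ e.isIdem
  rw [imageVertex, dif_neg hx, hE]
  have hx' := (exists_vertex hx).choose_spec
  generalize (exists_vertex hx).choose = x' at hx'
  have h : X.kriegerAction.act (X.vertex x') (X.cls u) =
      X.kriegerAction.act (X.vertex x) (X.cls u) := by
    rw [hx', hu, ← X.kriegerAction.act_mul, e.isIdem]
  rw [← hu] at hx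
  exact R.act_substLeft_eq hku hui (act_vertex_ne_point_iff.1 (h ▸ hx))
    (act_vertex_ne_point_iff.1 hx) h

theorem exists_imageVertex_eq {e : X.𝕂} {q : X.Q} (hq : q ∈ X.𝔸.obj e) (hq0 : q ≠ X.Q.point) :
    ∃ x, X.kriegerAction.act (X.vertex x) e.idem = q ∧
      imageVertex f k e q = Y.kriegerAction.act (Y.vertex (substLeft f x)) (imageIdem f k e) := by
  obtain ⟨x, rfl⟩ := exists_vertex hq0
  have h := act_idem_of_mem hq
  refine ⟨x, h, ?_⟩
  conv_lhs => rw [← h]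
  exact R.imageVertex_act (h.symm ▸ hq0)

theorem act_substLeft_ne_point {e : X.𝕂} {x : ℕ → X.alphabet}
    (hx : X.kriegerAction.act (X.vertex x) e.idem ≠ X.Q.point) :
    Y.kriegerAction.act (Y.vertex (substLeft f x)) (imageIdem f k e) ≠ Y.Q.point := by
  obtain ⟨u, hu, hku, hE⟩ := exists_imageIdem_eq f k (idem_ne_zero_of_act_ne_point hx)
  have hui : IsIdempotentElem (X.cls u) := hu ▸ e.isIdem
  rw [← hu, act_vertex_ne_point_iff] at hx
  rw [hE, act_vertex_ne_point_iff, letters_lift]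
  exact R.follows_substLeft (letters_ne_nil _)
    (by simpa using (follows_cube hui []).2 (by simpa using hx))

theorem imageVertex_injOn (e : X.𝕂) : Set.InjOn (imageVertex f k e) (X.𝔸.obj e) := by
  have key : ∀ q ∈ X.𝔸.obj e, imageVertex f k e q = Y.Q.point → q = X.Q.point := by
    intro q hq h
    by_contra hq0
    obtain ⟨x, hx, e₁⟩ := R.exists_imageVertex_eq hq hq0
    exact R.act_substLeft_ne_point (by rwa [hx]) (e₁.symm.trans h)
  intro q hq q' hq' h
  by_cases hq0 : q = X.Q.point
  · rw [hq0, imageVertex_point] at h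
    rw [hq0, key q' hq' h.symm]
  by_cases hq0' : q' = X.Q.point
  · rw [hq0', imageVertex_point] at h
    exact absurd (key q hq h) hq0
  obtain ⟨x, hx, e₁⟩ := R.exists_imageVertex_eq hq hq0
  obtain ⟨x', hx', e₂⟩ := R.exists_imageVertex_eq hq' hq0'
  rw [e₁, e₂] at h
  have he := idem_ne_zero_of_act_ne_point (hx.symm ▸ hq0)
  obtain ⟨u, hu, hku, hE⟩ := exists_imageIdem_eq f k he
  have hui : IsIdempotentElem (X.cls u) := hu ▸ e.isIdem
  rw [← hx, ← hx', ← hu]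
  rw [hE] at h
  rw [← hx, ← hu, ← Ne, act_vertex_ne_point_iff] at hq0
  rw [← hx', ← hu, ← Ne, act_vertex_ne_point_iff] at hq0'
  exact R.act_eq_of_act_substLeft_eq hku hui hq0 hq0' h

theorem imageVertex_surjOn (e : X.𝕂) : Set.SurjOn (imageVertex f k e) (X.𝔸.obj e)
    (Set.range fun q => Y.kriegerAction.act q (imageIdem f k e)) := by
  rintro _ ⟨q, rfl⟩
  dsimp only
  by_cases h0 : Y.kriegerAction.act q (imageIdem f k e) = Y.Q.point
  · exact ⟨X.Q.point, X.𝔸.point_mem e, by rw [imageVertex_point, h0]⟩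
  have hq : q ≠ Y.Q.point := by
    rintro rfl
    exact h0 (Y.kriegerAction.point_act _)
  obtain ⟨b, rfl⟩ := exists_vertex hq
  have he : e.idem ≠ 0 := fun h => h0 (by
    rw [imageIdem_of_eq_zero f k h, Y.kriegerAction.act_zero])
  obtain ⟨u, hu, hku, hE⟩ := exists_imageIdem_eq f k he
  have hui : IsIdempotentElem (X.cls u) := hu ▸ e.isIdem
  rw [hE, ← Ne, act_vertex_ne_point_iff, letters_lift] at h0
  obtain ⟨x, hxu, hx⟩ := R.exists_substLeft_eq_appendWord hku
    (by rwa [map_mul, map_mul, hui, hui, hu]) h0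
  refine ⟨X.kriegerAction.act (X.vertex x) e.idem, ⟨_, rfl⟩, ?_⟩
  rw [R.imageVertex_act (by rwa [← hu, act_vertex_ne_point_iff]), hx, hE, ← letters_lift,
    ← act_vertex_cls, act_act_cls]
  congr 1
  rw [← map_mul]
  have := R.cls_lift_mul_mul hku hui (hu ▸ he) (w := u * u) (by simp only [map_mul, hui.eq])
  simpa only [mul_assoc] using this

/-- With q = C(x)·e, absorbing u³w into the sequence rewrites q·s as C(xu³w)·d and the right-hand
side as C(f(xu³w))·D. These correspond by `imageVertex_act` unless the first is ∅; then
`follows_of_substLeft` forces the second to be ∅ too. -/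
theorem imageVertex_naturality {d e : X.𝕂} (s : Karoubi.Hom d e) {q : X.Q} (hq : q ∈ X.𝔸.obj e) :
    imageVertex f k d (X.kriegerAction.act q s.val) =
      Y.kriegerAction.act (imageVertex f k e q) (imageHom f k s) := by
  by_cases hq0 : q = X.Q.point
  · rw [hq0, X.kriegerAction.point_act, imageVertex_point, imageVertex_point,
      Y.kriegerAction.point_act]
  by_cases hs : s.val = 0
  · rw [hs, X.kriegerAction.act_zero, imageVertex_point, imageHom_of_eq_zero hs,
      Y.kriegerAction.act_zero]
  obtain ⟨x, hx, e₁⟩ := R.exists_imageVertex_eq hq hq0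
  obtain ⟨w, hw⟩ := exists_cls hs
  obtain ⟨u, hu, hku, hE⟩ := exists_imageIdem_eq f k (Karoubi.Hom.target_ne_zero hs)
  obtain ⟨v, hv, hkv, hD⟩ := exists_imageIdem_eq f k (Karoubi.Hom.source_ne_zero hs)
  have hui : IsIdempotentElem (X.cls u) := hu ▸ e.isIdem
  have hvi : IsIdempotentElem (X.cls v) := hv ▸ d.isIdem
  have hR : Y.kriegerAction.act (imageVertex f k e q) (imageHom f k s) =
      Y.kriegerAction.act (Y.vertex (substLeft f (appendWord x (letters (u * u * u * w)))))
        (imageIdem f k d) := by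
    rw [e₁, R.imageHom_eq hs hw, ← Y.kriegerAction.act_mul, ← mul_assoc, ← mul_assoc,
      R.isIdempotentElem_imageIdem e, Y.kriegerAction.act_mul, hE, ← map_mul, ← map_mul,
      act_vertex_cls, substLeft_appendWord, letters_lift]
  have hL : X.kriegerAction.act q s.val = X.kriegerAction.act
      (X.vertex (appendWord x (letters (u * u * u * w)))) d.idem := by
    rw [← act_vertex_cls, ← hv, act_act_cls, ← hx, ← X.kriegerAction.act_mul]
    congr 1
    rw [map_mul, map_mul, map_mul, map_mul, hui, hui, hu, hv, hw, s.mem, s.left_mul]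
  have hm : X.cls (u * u * u * w * v * v * v) ≠ 0 := by
    simpa only [map_mul, hu, hv, hw, e.isIdem.eq, s.left_mul, s.mul_right] using hs
  rw [hL, hR]
  by_cases h0 : X.kriegerAction.act
      (X.vertex (appendWord x (letters (u * u * u * w)))) d.idem = X.Q.point
  · rw [h0, imageVertex_point]
    by_contra hne
    rw [← Ne, ne_comm, hD, substLeft_appendWord, ← letters_lift, ← act_vertex_cls, act_act_cls,
      ← map_mul, act_vertex_ne_point_iff, letters_lift] at hne
    have hxu : Follows x (letters (u * u * u)) := by
      rw [← hx, ← hu, ← Ne, act_vertex_ne_point_iff] at hq0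
      simpa using (follows_cube hui []).2 (by simpa using hq0)
    have := R.follows_of_substLeft hku hkv hxu hm (by simpa only [mul_assoc] using hne)
    rw [← act_vertex_ne_point_iff] at this
    refine this ?_
    rw [← h0, ← act_vertex_cls, ← hv, act_act_cls]
  · exact R.imageVertex_act h0

/-- The natural isomorphism between the actions of the Karoubi envelopes. -/
noncomputable def natIso : X.𝔸.functor ≅ R.functor.op ⋙ Y.𝔸.functor :=
  NatIso.ofComponents (fun e => Pointed.Iso.mk
      (α := ⟨X.𝔸.obj e.unop, ⟨X.Q.point, X.𝔸.point_mem e.unop⟩⟩)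
      (β := ⟨Y.𝔸.obj (R.functor.obj e.unop), ⟨Y.Q.point, Y.𝔸.point_mem (R.functor.obj e.unop)⟩⟩)
      (Equiv.ofBijective (fun q : X.𝔸.obj e.unop =>
          (⟨imageVertex f k e.unop q.1, imageVertex_mem f k e.unop q.1⟩ :
            Y.𝔸.obj (R.functor.obj e.unop)))
        ⟨fun q q' h => Subtype.ext (R.imageVertex_injOn e.unop q.2 q'.2 (congrArg Subtype.val h)),
          fun q => by
            obtain ⟨q', hq', h⟩ := R.imageVertex_surjOn e.unop q.2
            exact ⟨⟨q', hq'⟩, Subtype.ext h⟩⟩)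
      (Subtype.ext (imageVertex_point f k e.unop)))
    fun {d e} s => Pointed.Hom.ext (funext fun q =>
      Subtype.ext (R.imageVertex_naturality s.unop q.2))

theorem equivalent : X.𝔸.Equivalent Y.𝔸 :=
  ⟨⟨R.functor, inferInstance, R.natIso.hom⟩, show R.functor.IsEquivalence from {},
    show IsIso R.natIso.hom from inferInstance⟩

end Recognizable

/-! ### Conjugacies: periodic points and injective letter-to-letter codes -/

section Blocks

variable {A B : Type u}

theorem exists_block_eq_append (x : ℤ → A) {i j : ℤ} {m n : ℕ} (h : j ≤ i) (h' : i + n ≤ j + m) :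
    ∃ s t, block x j m = s ++ block x i n ++ t := by
  obtain ⟨a, ha⟩ := Int.eq_ofNat_of_zero_le (sub_nonneg.2 h)
  obtain ⟨b, hb⟩ := Int.eq_ofNat_of_zero_le (sub_nonneg.2 h')
  obtain rfl : m = a + n + b := by omega
  obtain rfl : i = j + a := by omega
  exact ⟨_, _, by rw [block_append, block_append]⟩

theorem map_block (φ : A → B) (x : ℤ → A) (i : ℤ) (n : ℕ) :
    (block x i n).map φ = block (φ ∘ x) i n := by
  simp [block]

theorem block_add_of_periodic {x : ℤ → A} {N : ℕ} (h : shift (N : ℤ) x = x) (n : ℕ) (m : ℕ) :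
    block x ((n * N : ℕ) : ℤ) m = block x 0 m := by
  induction n with
  | zero => simp
  | succ n ih =>
    rw [← ih]
    conv_rhs => rw [← h, block_shift]
    congr 1
    push_cast; ring

theorem letters_wordPow_of_periodic {x : ℤ → A} {u : FreeSemigroup A}
    (h : shift (u.length : ℤ) x = x) (hu : block x 0 u.length = letters u) (n : ℕ) :
    letters (wordPow u n) = block x 0 ((n + 1) * u.length) := by
  induction n with
  | zero => rw [wordPow, ← hu]; simp
  | succ n ih =>
    rw [wordPow, letters_mul, ih, add_mul (n + 1), one_mul, block_append, zero_add,
      block_add_of_periodic h, hu]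

theorem exists_periodic_point (u : FreeSemigroup A) : ∃ x : ℤ → A,
    shift (u.length : ℤ) x = x ∧ block x 0 u.length = letters u := by
  have h0 : 0 < u.length := Nat.succ_pos _
  have hN : (0 : ℤ) < u.length := by exact_mod_cast h0
  have hlt : ∀ i : ℤ, (i % u.length).toNat < (letters u).length := fun i => by
    have h1 := Int.emod_lt_of_pos i hN
    have h2 := Int.emod_nonneg i hN.ne'
    rw [length_letters]
    omega
  refine ⟨fun i => (letters u)[(i % u.length).toNat]'(hlt i), ?_, ?_⟩
  · funext i
    simp only [shift_apply]
    congr 2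
    rw [Int.add_emod_left]
  · refine List.ext_getElem (by rw [length_block, length_letters]) fun i h1 h2 => ?_
    rw [getElem_block]
    congr 1
    rw [length_letters] at h2
    rw [zero_add, Int.emod_eq_of_lt (by omega) (by omega)]
    rfl

end Blocks

theorem mem_of_periodic {x : ℤ → X.alphabet} {u : FreeSemigroup X.alphabet}
    (h : shift (u.length : ℤ) x = x) (hu : block x 0 u.length = letters u)
    (hL : ∀ n, letters (wordPow u n) ∈ X.language) : x ∈ X.toSubshift.carrier := by
  have h0 : 0 < u.length := Nat.succ_pos _
  refine mem_of_block_mem_language fun n => ?_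
  have h1 := hL (2 * n + 1)
  -- Moving the window n periods to the right brings it to nonnegative positions, inside a power of
  -- u.
  have e : block x (-(n : ℤ)) (n + (1 + n)) =
      block x (((n * u.length : ℕ) : ℤ) - n) (n + (1 + n)) := by
    rw [block_eq_iff]
    intro k _
    have key : ∀ (m : ℕ) (i : ℤ), x (((m * u.length : ℕ) : ℤ) + i) = x i := by
      intro m i
      induction m with
      | zero => simp
      | succ m ih =>
        rw [← ih]
        conv_rhs => rw [← h, shift_apply]
        congr 1
        push_cast; ring
    rw [← key n]
    congr 1
    ring
  have hn : n ≤ n * u.length := Nat.le_mul_of_pos_right n h0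
  obtain ⟨s, t, hst⟩ := exists_block_eq_append x (i := ((n * u.length : ℕ) : ℤ) - n) (j := 0)
    (m := (2 * n + 1 + 1) * u.length) (n := n + (1 + n)) (by omega) (by
      have : (2 * n + 1 + 1) * u.length = n * u.length + (n * u.length + 2 * u.length) := by ring
      omega)
  rw [letters_wordPow_of_periodic h hu, hst] at h1
  rw [e]
  refine mem_language_of_append h1 (List.ne_nil_of_length_pos ?_)
  rw [length_block]
  omega

theorem substWord_of {A B : Type u} (φ : A → B) (w : List A) :
    substWord (fun a => FreeSemigroup.of (φ a)) w = w.map φ := by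
  induction w with
  | nil => rfl
  | cons a w ih => rw [substWord_cons, ih]; rfl

/-- The inverse of an injective letter-to-letter map is a sliding block code. -/
theorem exists_window {B : Type u} (φ : X.alphabet → B)
    (hinj : ∀ x ∈ X.toSubshift.carrier, ∀ x' ∈ X.toSubshift.carrier, φ ∘ x = φ ∘ x' → x = x') :
    ∃ k : ℕ, ∀ x ∈ X.toSubshift.carrier, ∀ x' ∈ X.toSubshift.carrier,
      (∀ i : ℤ, -(k : ℤ) ≤ i → i ≤ k → φ (x i) = φ (x' i)) → x 0 = x' 0 := by
  by_contra! hc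
  choose p hp p' hp' hpp hne using hc
  -- Pairs with equal images on [-k, k] but different letters at 0 accumulate at a pair of points
  -- with the same image that still differ at 0. The second cluster point is taken along the indices
  -- `ν` of the first.
  obtain ⟨q, hq, hqp⟩ := exists_cluster_point p hp
  choose ν hν hqν using hqp
  obtain ⟨q', hq', hqp'⟩ := exists_cluster_point (fun N => p' (ν N)) fun N => hp' _
  have h : q = q' := by
    refine hinj q hq q' hq' (funext fun i => ?_)
    obtain ⟨M, hM, e⟩ := hqp' i.natAbs
    rw [Function.comp_apply, Function.comp_apply, e i (by omega) (by omega),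
      hqν M i (by omega) (by omega)]
    have := hν M
    exact hpp _ i (by omega) (by omega)
  obtain ⟨M, -, e⟩ := hqp' 0
  refine hne (ν M) ?_
  rw [← hqν M 0 (by omega) (by omega), h]
  exact e 0 (by simp) (by simp)

/-- A letter-to-letter map inducing a bijection between shifts is recognizable. -/
theorem exists_recognizable_of (φ : X.alphabet → Y.alphabet)
    (hmaps : ∀ x ∈ X.toSubshift.carrier, φ ∘ x ∈ Y.toSubshift.carrier)
    (hsurj : ∀ y ∈ Y.toSubshift.carrier, ∃ x ∈ X.toSubshift.carrier, φ ∘ x = y)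
    (hinj : ∀ x ∈ X.toSubshift.carrier, ∀ x' ∈ X.toSubshift.carrier, φ ∘ x = φ ∘ x' → x = x') :
    ∃ k, Recognizable X Y (fun a => FreeSemigroup.of (φ a)) k := by
  obtain ⟨k, hk⟩ := exists_window φ hinj
  refine ⟨k, fun w hw => ?_, fun w hw => ?_, ?_, fun r hr => ?_⟩
  · obtain ⟨x, hx, i, n, rfl⟩ := hw
    rw [substWord_of, map_block]
    exact ⟨_, hmaps x hx, i, n, rfl⟩
  · obtain ⟨y, hy, i, n, rfl⟩ := hw
    obtain ⟨x, hx, rfl⟩ := hsurj y hy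
    exact ⟨block x i (n + 1), ⟨x, hx, i, n, rfl⟩, [], [], by simp [substWord_of, map_block]⟩
  · intro p z q v s t hz hp hq hpzq hv e
    simp only [substWord_of] at e ⊢
    obtain ⟨v', v₂, rfl, e', rfl⟩ := List.map_eq_append_iff.1 e
    obtain ⟨v₁, w, rfl, rfl, ew⟩ := List.map_eq_append_iff.1 e'
    have ew' := ew
    rw [List.map_append, List.map_append] at ew'
    obtain ⟨pz', q', rfl, epz, eq'⟩ := List.map_eq_append_iff.1 ew'
    obtain ⟨p', z', rfl, ep, ez⟩ := List.map_eq_append_iff.1 epz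
    have lp : p'.length = p.length := by simpa using congrArg List.length ep
    have lz : z'.length = z.length := by simpa using congrArg List.length ez
    have lq : q'.length = q.length := by simpa using congrArg List.length eq'
    obtain ⟨x, hx, ex⟩ := exists_block_eq hpzq 0
    obtain ⟨x', hx', ex'⟩ := exists_block_eq (mem_language_of_append (w := p' ++ z' ++ q') hv
      (List.ne_nil_of_length_pos (by
        have := List.length_pos_iff.2 hz
        simp only [List.length_append]; omega))) 0
    have hφ := ew
    rw [← ex, ← ex', map_block, map_block, show (p' ++ z' ++ q').length = (p ++ z ++ q).length by
      simp [lp, lz, lq], block_eq_iff] at hφ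
    simp only [List.length_append] at hφ
    -- Around each letter of z there are k further letters on both sides with equal images, which is
    -- the window of the inverse code.
    have hz' : block x p.length z.length = block x' p.length z.length := by
      rw [block_eq_iff]
      intro i hi
      have := hk (shift (p.length + i) x) (X.toSubshift.mapsTo _ hx) (shift (p.length + i) x')
        (X.toSubshift.mapsTo _ hx') fun j hj hj' => by
          obtain ⟨a, ha⟩ := Int.eq_ofNat_of_zero_le (show 0 ≤ (p.length + i : ℤ) + j by omega)
          have := hφ a (by omega)
          rw [shift_apply, shift_apply, ha]
          simpa using this.symm
      simpa [shift_apply] using this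
    have hzz : ∀ {x : ℤ → X.alphabet} {p z q : List X.alphabet},
        block x 0 (p ++ z ++ q).length = p ++ z ++ q → block x p.length z.length = z := by
      intro x p z q h
      rw [List.length_append, List.length_append, block_append, block_append, zero_add] at h
      exact (List.append_inj (List.append_inj h (by simp)).1 (by simp)).2
    have ez' : z' = z := by
      rw [← hzz ex, ← hzz ex', hz', lp, lz]
    exact ⟨v₁ ++ p', q' ++ v₂, by rw [ez']; simp, by rw [List.map_append, ep],
      by rw [List.map_append, eq']⟩
  · obtain ⟨y, hy, hyr⟩ := exists_periodic_point r
    obtain ⟨x, hx, rfl⟩ := hsurj y (mem_of_periodic hy hyr hr)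
    -- Uniqueness of preimages makes the period of the image a period of x.
    have hxp : shift (r.length : ℤ) x = x :=
      hinj _ (X.toSubshift.mapsTo _ hx) _ hx (by conv_rhs => rw [← hy]
                                                 rfl)
    have h0 : 0 < r.length := Nat.succ_pos _
    obtain ⟨u, hu⟩ := exists_letters (l := block x 0 r.length)
      (List.ne_nil_of_length_pos (by rwa [length_block]))
    have hl : u.length = r.length := by rw [← length_letters, hu, length_block]
    refine ⟨u, [], letters r, rfl, ?_, fun n => ?_⟩
    · rw [substWord_of, hu, map_block, hyr, List.append_nil]
    · rw [letters_wordPow_of_periodic (x := x) (by rw [hl, hxp]) (by rw [hl, hu])]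
      exact X.block_mem_language hx 0 (by rw [hl]; positivity)

theorem map_shift_of_conjugacy (Φ : X.toSubshift.carrier ≃ₜ Y.toSubshift.carrier)
    (hΦ : ∀ x : X.toSubshift.carrier,
      (Φ ⟨shift 1 x.1, X.toSubshift.mapsTo 1 x.2⟩ : ℤ → Y.alphabet) = shift 1 (Φ x).1)
    (g : ℤ) (x : X.toSubshift.carrier) :
    (Φ ⟨shift g x.1, X.toSubshift.mapsTo g x.2⟩ : ℤ → Y.alphabet) = shift g (Φ x).1 := by
  have key : ∀ (n : ℕ) (x : X.toSubshift.carrier),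
      (Φ ⟨shift (n : ℤ) x.1, X.toSubshift.mapsTo _ x.2⟩ : ℤ → Y.alphabet) =
        shift (n : ℤ) (Φ x).1 := by
    intro n
    induction n with
    | zero => intro x; simp [shift_zero]
    | succ n ih =>
      intro x
      have h : (⟨shift ((n + 1 : ℕ) : ℤ) x.1, X.toSubshift.mapsTo _ x.2⟩ : X.toSubshift.carrier) =
          ⟨shift 1 (shift (n : ℤ) x.1), X.toSubshift.mapsTo 1 (X.toSubshift.mapsTo _ x.2)⟩ :=
        Subtype.ext ((congrArg (shift · x.1) (Nat.cast_succ n)).trans (shift_add _ _ _))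
      rw [h]
      refine (hΦ ⟨shift (n : ℤ) x.1, X.toSubshift.mapsTo _ x.2⟩).trans ?_
      rw [ih x, ← shift_add, Nat.cast_succ]
  obtain ⟨n, rfl | rfl⟩ := g.eq_nat_or_neg
  · exact key n x
  · have := key n ⟨shift (-n) x.1, X.toSubshift.mapsTo _ x.2⟩
    simp only [← shift_add, neg_add_cancel, shift_zero] at this
    change (Φ x).1 = _ at this
    rw [this, ← shift_add, add_neg_cancel, shift_zero]

/-- The graph of Φ, as a shift over the product alphabet, projects bijectively onto X and Y by
letter-to-letter maps. So no block code for Φ itself is needed. -/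
theorem Conjugate.equivalent (h : Conjugate X Y) : X.𝔸.Equivalent Y.𝔸 := by
  obtain ⟨Φ, hΦ⟩ := h
  have hshift := map_shift_of_conjugacy Φ hΦ
  let G : X.toSubshift.carrier → ℤ → X.alphabet × Y.alphabet := fun x i => (x.1 i, (Φ x).1 i)
  have hG : Continuous G := by
    refine continuous_pi fun i => Continuous.prodMk ?_ ?_
    · exact (continuous_apply i).comp continuous_subtype_val
    · exact (continuous_apply i).comp (continuous_subtype_val.comp Φ.continuous)
  have : CompactSpace X.toSubshift.carrier :=
    isCompact_iff_compactSpace.1 X.toSubshift.isClosed.isCompact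
  let Z : ShiftSpace.{u} :=
    { alphabet := X.alphabet × Y.alphabet
      toSubshift :=
        { carrier := Set.range G
          isClosed := (isCompact_range hG).isClosed
          mapsTo := by
            rintro g _ ⟨x, rfl⟩
            refine ⟨⟨shift g x.1, X.toSubshift.mapsTo g x.2⟩, ?_⟩
            funext i
            simp only [G, hshift]
            rfl }
      nonempty := by
        obtain ⟨x, hx⟩ := X.nonempty
        exact ⟨_, ⟨x, hx⟩, rfl⟩ }
  obtain ⟨k, hk⟩ := exists_recognizable_of (X := Z) (Y := X) Prod.fst
    (by rintro _ ⟨x, rfl⟩; exact x.2) (fun x hx => ⟨_, ⟨⟨x, hx⟩, rfl⟩, rfl⟩) (by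
      rintro _ ⟨x, rfl⟩ _ ⟨x', rfl⟩ e
      exact congrArg G (Subtype.ext e))
  obtain ⟨l, hl⟩ := exists_recognizable_of (X := Z) (Y := Y) Prod.snd
    (by rintro _ ⟨x, rfl⟩; exact (Φ x).2)
    (fun y hy => ⟨_, ⟨Φ.symm ⟨y, hy⟩, rfl⟩, by
      change (Φ (Φ.symm ⟨y, hy⟩)).1 = y
      rw [Φ.apply_symm_apply]⟩) (by
      rintro _ ⟨x, rfl⟩ _ ⟨x', rfl⟩ e
      exact congrArg G (Φ.injective (Subtype.ext e)))
  exact hk.equivalent.symm.trans hl.equivalent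

theorem mul_wordPow_mul {A : Type u} (a b : FreeSemigroup A) (n : ℕ) :
    a * wordPow (b * a) n * b = wordPow (a * b) (n + 1) := by
  induction n with
  | zero => simp only [wordPow, mul_assoc]
  | succ n ih =>
    rw [wordPow, wordPow, ← ih]
    simp only [mul_assoc]

/-! ### Symbol expansions -/

section Expansion

variable {A B : Type u} (ι : Option A ≃ B) (α : A)

open Classical in
/-- The symbol expansion associated to the letter `α`, followed by the identification `ι` of the
alphabet `A ∪ {◇}` with `B`. -/
noncomputable def expandLetter (a : A) : FreeSemigroup B :=
  if a = α then ⟨ι (some α), [ι none]⟩ else ⟨ι (some a), []⟩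

theorem letters_expandLetter_self : letters (expandLetter ι α α) = [ι (some α), ι none] := by
  rw [expandLetter, if_pos rfl]
  rfl

theorem letters_expandLetter_of_ne {a : A} (h : a ≠ α) :
    letters (expandLetter ι α a) = [ι (some a)] := by
  rw [expandLetter, if_neg h]
  rfl

theorem head_expandLetter (a : A) : (expandLetter ι α a).head = ι (some a) := by
  by_cases h : a = α
  · rw [h, expandLetter, if_pos rfl]
  · rw [expandLetter, if_neg h]

theorem substWord_expandLetter (w : List A) :
    substWord (expandLetter ι α) w = (expandWord α w).map ι := by
  induction w with
  | nil => rfl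
  | cons a w ih =>
    rw [substWord_cons, ih]
    simp only [expandWord, List.flatMap_cons, List.map_append]
    congr 1
    by_cases h : a = α
    · rw [h, letters_expandLetter_self, if_pos rfl]; rfl
    · rw [letters_expandLetter_of_ne ι α h, if_neg h]; rfl

variable {ι α}

theorem head?_substWord_ne (w : List A) (t : List B) (hw : w ≠ []) :
    (substWord (expandLetter ι α) w ++ t).head? ≠ some (ι none) := by
  cases w with
  | nil => exact absurd rfl hw
  | cons a w =>
    rw [substWord_cons, letters, List.cons_append, List.cons_append, List.head?_cons,
      head_expandLetter]
    simp

/-- A factorization of an expanded word whose second factor does not begin with the new letter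
comes from a factorization of the word. -/
theorem exists_eq_append_of_substWord {v : List A} {s t : List B}
    (h : substWord (expandLetter ι α) v = s ++ t) (ht : t.head? ≠ some (ι none)) :
    ∃ v₁ v₂, v = v₁ ++ v₂ ∧ substWord (expandLetter ι α) v₁ = s ∧
      substWord (expandLetter ι α) v₂ = t := by
  induction v generalizing s with
  | nil =>
    obtain ⟨rfl, rfl⟩ := List.append_eq_nil_iff.1 h.symm
    exact ⟨[], [], rfl, rfl, rfl⟩
  | cons a v ih =>
    cases s with
    | nil => exact ⟨[], a :: v, rfl, rfl, h⟩
    | cons b s =>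
      by_cases ha : a = α
      · subst ha
        rw [substWord_cons, letters_expandLetter_self] at h
        cases s with
        | nil =>
          refine absurd ?_ ht
          simp only [List.cons_append, List.nil_append, List.cons.injEq] at h
          rw [← h.2, List.head?_cons]
        | cons c s =>
          simp only [List.cons_append, List.nil_append, List.cons.injEq] at h
          obtain ⟨rfl, rfl, h⟩ := h
          obtain ⟨v₁, v₂, rfl, rfl, e⟩ := ih h
          exact ⟨a :: v₁, v₂, rfl, by rw [substWord_cons, letters_expandLetter_self]; rfl, e⟩
      · rw [substWord_cons, letters_expandLetter_of_ne ι α ha] at h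
        simp only [List.cons_append, List.nil_append, List.cons.injEq] at h
        obtain ⟨rfl, h⟩ := h
        obtain ⟨v₁, v₂, rfl, rfl, e⟩ := ih h
        exact ⟨a :: v₁, v₂, rfl, by rw [substWord_cons, letters_expandLetter_of_ne ι α ha]; rfl, e⟩

/-- The image of a letter determines that letter by its first symbol, so desubstitution from the
left is deterministic. -/
theorem exists_eq_append_of_substWord_eq {v w : List A} {t : List B}
    (h : substWord (expandLetter ι α) v = substWord (expandLetter ι α) w ++ t) :
    ∃ v₂, v = w ++ v₂ ∧ substWord (expandLetter ι α) v₂ = t := by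
  induction w generalizing v with
  | nil => exact ⟨v, rfl, h⟩
  | cons b w ih =>
    cases v with
    | nil => simp [letters] at h
    | cons a v =>
      have hab : a = b := by
        have := congrArg List.head? h
        simpa [letters, head_expandLetter] using this
      subst hab
      rw [substWord_cons, substWord_cons, List.append_assoc, List.append_right_inj] at h
      obtain ⟨v₂, rfl, e⟩ := ih h
      exact ⟨v₂, rfl, e⟩

/-- The image of z does not begin with ◇, so it starts at a boundary between images of letters, and
from there reading is deterministic. No margins are needed, whence k = 0. -/
theorem exists_eq_append_append_of_substWord {v z : List A} {s t : List B} (hz : z ≠ [])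
    (h : substWord (expandLetter ι α) v = s ++ substWord (expandLetter ι α) z ++ t) :
    ∃ v₁ v₂, v = v₁ ++ z ++ v₂ ∧ substWord (expandLetter ι α) v₁ = s ∧
      substWord (expandLetter ι α) v₂ = t := by
  rw [List.append_assoc] at h
  obtain ⟨v₁, v₂, rfl, e₁, e₂⟩ := exists_eq_append_of_substWord h (head?_substWord_ne z t hz)
  obtain ⟨v₃, rfl, e₃⟩ := exists_eq_append_of_substWord_eq e₂
  exact ⟨v₁, v₃, by simp, e₁, e₃⟩

theorem substWord_ne_of_two_diamonds (v : List A) (s t : List B) :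
    substWord (expandLetter ι α) v ≠ s ++ ι none :: ι none :: t := by
  induction v generalizing s with
  | nil => simp
  | cons a v ih =>
    have hv : ∀ t, substWord (expandLetter ι α) v ≠ ι none :: t := by
      intro t h
      cases v with
      | nil => simp at h
      | cons b v =>
        refine head?_substWord_ne (ι := ι) (α := α) (b :: v) [] (by simp) ?_
        rw [List.append_nil, h, List.head?_cons]
    intro h
    by_cases ha : a = α
    · subst ha
      rw [substWord_cons, letters_expandLetter_self] at h
      match s with
      | [] => simp at h
      | [b] =>
        simp only [List.cons_append, List.nil_append, List.cons.injEq, true_and] at h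
        exact hv _ h.2
      | b :: c :: s =>
        simp only [List.cons_append, List.nil_append, List.cons.injEq] at h
        exact ih s h.2.2
    · rw [substWord_cons, letters_expandLetter_of_ne ι α ha] at h
      match s with
      | [] => simp at h
      | b :: s =>
        simp only [List.cons_append, List.nil_append, List.cons.injEq] at h
        exact ih s h.2

end Expansion

variable {X' : ShiftSpace.{u}}

/-- The subshift of the sequences all of whose blocks belong to `N`. -/
def subshiftOfBlocks {B : Type u} [TopologicalSpace B] [DiscreteTopology B] (N : Set (List B)) :
    Subshift B ℤ where
  carrier := {z | ∀ (i : ℤ) (n : ℕ), block z i (n + 1) ∈ N}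
  isClosed := by
    simp only [Set.ofPred_forall]
    refine isClosed_iInter fun i => isClosed_iInter fun n => ?_
    have h : Continuous fun (z : ℤ → B) (k : Fin (n + 1)) => z (i + (k : ℕ)) :=
      continuous_pi fun k => continuous_apply _
    have := (isClosed_discrete {g : Fin (n + 1) → B | List.ofFn g ∈ N}).preimage h
    convert this using 1
    ext z
    simp only [Set.mem_ofPred_eq, Set.mem_preimage]
    rw [show block z i (n + 1) = List.ofFn fun k : Fin (n + 1) => z (i + (k : ℕ)) by
      refine List.ext_getElem (by simp) fun k h1 h2 => ?_
      rw [getElem_block, List.getElem_ofFn]]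
  mapsTo g z hz i n := by
    rw [block_shift]
    exact hz _ _

/-- Minimality is applied to the subshift of sequences whose blocks are all factors of images. It
contains the image of every word u of X: u is padded by n letters on both sides, points of X'
showing the image of the padded word are taken, and a cluster point has all its blocks inside such
images. -/
theorem exists_factor_of_isSymbolExpansion {f : X.alphabet → FreeSemigroup X'.alphabet}
    (hmem : ∀ u ∈ X.language, substWord f u ∈ X'.language)
    (hleast : ∀ Z : Subshift X'.alphabet ℤ,
      (∀ u ∈ X.language, substWord f u ∈ blocks Z.carrier) →
        X'.toSubshift.carrier ⊆ Z.carrier) :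
    ∀ w ∈ X'.language, ∃ v ∈ X.language, ∃ s t, substWord f v = s ++ w ++ t := by
  have h := hleast (subshiftOfBlocks {w | ∃ v ∈ X.language, ∃ s t, substWord f v = s ++ w ++ t}) ?_
  · rintro w ⟨x, hx, i, n, rfl⟩
    exact h hx i n
  intro u hu
  choose l r hl hr hlr using fun n => exists_append_mem_language hu n n
  choose p hp hpb using fun n : ℕ =>
    exists_block_eq (hmem _ (hlr n)) (-((substWord f (l n)).length : ℤ))
  obtain ⟨q, hq, hqp⟩ := exists_cluster_point p hp
  have hll : ∀ n, n ≤ (substWord f (l n)).length := fun n =>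
    (hl n).symm.le.trans (length_le_length_substWord f _)
  have hrl : ∀ n, n ≤ (substWord f (r n)).length := fun n =>
    (hr n).symm.le.trans (length_le_length_substWord f _)
  refine ⟨q, fun i n => ?_, 0, (substWord f u).length - 1, ?_⟩
  · obtain ⟨m, hm, e⟩ := hqp (i.natAbs + n + 1)
    have h1 : block q i (n + 1) = block (p m) i (n + 1) := by
      rw [block_eq_iff]
      exact fun k hk => e _ (by omega) (by omega)
    have h2 := hll m
    have h3 := hrl m
    obtain ⟨s, t, hst⟩ := exists_block_eq_append (p m) (i := i)
      (j := -((substWord f (l m)).length : ℤ)) (m := (substWord f (l m ++ u ++ r m)).length)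
      (n := n + 1) (by omega) (by
        simp only [substWord_append, List.length_append]
        omega)
    rw [hpb] at hst
    rw [h1]
    exact ⟨_, hlr m, s, t, hst⟩
  · obtain ⟨m, hm, e⟩ := hqp (substWord f u).length
    have h0 : 0 < (substWord f u).length := List.length_pos_iff.2
      fun h => ne_nil_of_mem_language hu ((substWord_eq_nil_iff f).1 h)
    rw [Nat.sub_add_cancel h0]
    have h1 := hpb m
    rw [substWord_append, substWord_append, List.length_append, List.length_append, block_append,
      block_append, neg_add_cancel] at h1
    have h2 := (List.append_inj (List.append_inj h1 (by simp)).1 (by simp)).2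
    conv_lhs => rw [← h2]
    rw [block_eq_iff]
    exact fun k hk => (e _ (by omega) (by omega)).symm

/-- Since r does not begin with ◇, both copies in r r start at boundaries between images of letters,
so the first copy is itself the image of a word u; powers of u are then found in X by desubstituting
powers of r. -/
theorem periodic_expandLetter {ι : Option X.alphabet ≃ X'.alphabet} {α : X.alphabet}
    (hfac : ∀ w ∈ X'.language, ∃ v ∈ X.language, ∃ s t,
      substWord (expandLetter ι α) v = s ++ w ++ t)
    {r : FreeSemigroup X'.alphabet} (hr : ∀ n, letters (wordPow r n) ∈ X'.language)
    (hr0 : r.head ≠ ι none) : ∃ u : FreeSemigroup X.alphabet,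
      substWord (expandLetter ι α) (letters u) = letters r ∧
        ∀ n, letters (wordPow u n) ∈ X.language := by
  have hhead : ∀ t, (letters r ++ t).head? ≠ some (ι none) := by
    intro t
    simpa [letters] using hr0
  obtain ⟨v, hv, s, t, e⟩ := hfac _ (hr 1)
  rw [wordPow, wordPow, letters_mul, List.append_assoc, List.append_assoc] at e
  obtain ⟨v₁, v₂, rfl, -, e₂⟩ := exists_eq_append_of_substWord e (hhead _)
  obtain ⟨u, v₃, rfl, e₃, -⟩ := exists_eq_append_of_substWord e₂ (hhead _)
  obtain ⟨u, rfl⟩ := exists_letters (l := u) (by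
    rintro rfl
    exact letters_ne_nil r e₃.symm)
  refine ⟨u, e₃, fun n => ?_⟩
  obtain ⟨x, hx, s', t', e'⟩ := hfac _ (hr n)
  have hur : FreeSemigroup.lift (expandLetter ι α) u = r := letters_injective (by
    rw [letters_lift, e₃])
  rw [← hur, ← map_wordPow, letters_lift] at e'
  obtain ⟨x₁, x₂, rfl, -, -⟩ := exists_eq_append_append_of_substWord (letters_ne_nil _) e'
  exact mem_language_of_append hx (letters_ne_nil _)

theorem IsSymbolExpansion.equivalent (h : IsSymbolExpansion X X') : X.𝔸.Equivalent X'.𝔸 := by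
  obtain ⟨ι, α, hmem, hleast⟩ := h
  simp only [← substWord_expandLetter] at hmem hleast
  have hfac := exists_factor_of_isSymbolExpansion hmem hleast
  suffices R : Recognizable X X' (expandLetter ι α) 0 from R.equivalent
  refine ⟨hmem, hfac, fun p z q v s t hz _ _ _ _ e => ?_, fun r hr => ?_⟩
  · obtain ⟨v₁, v₂, rfl, rfl, rfl⟩ := exists_eq_append_append_of_substWord (by simp [hz]) e
    exact ⟨v₁ ++ p, q ++ v₂, by simp, by simp, by simp⟩
  -- A period starting with ◇ begins in the middle of the image of α. Moving this ◇ to the end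
  -- helps: what remains is nonempty and does not begin with ◇, as ◇◇ never occurs in an image.
  by_cases hr0 : r.head = ι none
  · obtain ⟨v, hv, s, t, e⟩ := hfac _ (hr 1)
    obtain ⟨b, r⟩ := r
    obtain rfl : b = ι none := hr0
    rw [wordPow, wordPow, letters_mul] at e
    cases r with
    | nil => exact absurd e (by simpa [letters] using substWord_ne_of_two_diamonds v s t)
    | cons c r =>
      have hc : c ≠ ι none := by
        rintro rfl
        exact substWord_ne_of_two_diamonds v s _ (by rw [e]; simp [letters]; rfl)
      let d : FreeSemigroup X'.alphabet := ⟨ι none, []⟩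
      let ρ : FreeSemigroup X'.alphabet := ⟨c, r⟩
      obtain ⟨u, hu, hun⟩ := periodic_expandLetter hfac (r := ρ * d) (fun n => by
        have := hr (n + 1)
        change letters (wordPow (d * ρ) (n + 1)) ∈ _ at this
        rw [← mul_wordPow_mul, letters_mul, letters_mul] at this
        exact mem_language_of_append this (letters_ne_nil _)) hc
      exact ⟨u, letters d, letters ρ, rfl, by rw [hu, letters_mul], hun⟩
  · obtain ⟨u, hu, hun⟩ := periodic_expandLetter hfac hr hr0
    exact ⟨u, [], letters r, rfl, by rw [hu, List.append_nil], hun⟩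

theorem FlowEquivalent.equivalent (h : FlowEquivalent X Y) :
    X.𝔸.Equivalent Y.𝔸 := by
  induction h with
  | rel _ _ h => exact h.elim Conjugate.equivalent IsSymbolExpansion.equivalent
  | refl _ => exact CategoryAction.Equivalent.refl _
  | symm _ _ _ ih => exact ih.symm
  | trans _ _ _ _ _ ih ih' => exact ih.trans ih'

end ShiftKaroubi

theorem theoremt (X Y : ShiftSpace.{u}) (h : FlowEquivalent X Y) :
    X.𝔸.Equivalent Y.𝔸 ∧
      ∀ (𝒞 : Type v) [Category.{w} 𝒞]
        (I : ∀ (S : Type u) [SemigroupWithZero S] (Q : Pointed.{u}), SemigroupAction₀ S Q → 𝒞),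
        IsKaroubiInvariant I →
          Nonempty (I X.S X.Q X.kriegerAction ≅ I Y.S Y.Q Y.kriegerAction) := by
  have hE := h.equivalent
  exact ⟨hE, fun _ _ _ hI => hI _ _ _ _ _ _ hE⟩
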